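/- Let $\mathcal Q=\{(u,v): 1\le u\le v<\infty\}$, with axis $\Gamma=\{u=v\}$, and for real functions on $\mathcal Q$ let $C_u=\{u\}\times[u,\infty)$ and $\underline C_v=[1,v]\times\{v\}$. First derivatives $\partial_v f$, $\partial_u f$ of functions whose derivatives have bounded variation denote the right-continuous representatives (i.e. derivatives from the right; $\partial_u$ is considered off the axis), and T.V. denotes total variation. For $(\phi,r,m)$ on $\mathcal Q$ put $\lambda=\partial_v r$, $\nu=\partial_u r$, $\mu=2m/r$, $\Omega^2=-4\lambda\nu/(1-\mu)$. *Solutions.* $(\phi,r,m)$ is a solution of the spherically symmetric Einstein–scalar field system if $r>0$ and $\Omega^2>0$ on $\mathcal Q\setminus\Gamma$, $r=m=0$ on $\Gamma$, $v=2r+1$ on $C_1$ (so $\lambda(1,\cdot)=\tfrac12$), and $$\partial_u\lambda=\partial_v\nu=\frac{\mu\lambda\nu}{(1-\mu)r},\quad 2\nu\,\partial_u m=(1-\mu)r^2(\partial_u\phi)^2,\quad 2\lambda\,\partial_v m=(1-\mu)r^2(\partial_v\phi)^2,\quad \partial_u\partial_v(r\phi)=\partial_v\partial_u(r\phi)=\frac{\mu\lambda\nu}{(1-\mu)r}\phi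 ,$$ where along every null curve $r,\phi,m$ are absolutely continuous up to the axis, $\lambda,\partial_v(r\phi)$ (in $u$) and $\nu,\partial_u(r\phi)$ (in $v$) are locally absolutely continuous off the axis, and the equations hold almost everywhere. It is a *BV solution* if on each $\mathcal D(u_0,v_0)=\{u_0\le u\le v\le v_0\}$ ($1\le u_0\le v_0$): $\sup(-\nu)<\infty$; $\lambda>0$ and $\sup\lambda^{-1}<\infty$; $\lambda$, $\phi$, $\partial_v(r\phi)$ have total variation on $C_u\cap\mathcal D(u_0,v_0)$ bounded uniformly in $u$, and $\nu$, $\phi$, $\partial_u(r\phi)$ have total variation on $\underline C_v\cap\mathcal D(u_0,v_0)$ bounded uniformly in $v$; and if for every $a\ge1$ $$\lim_{\epsilon\to0+}(\nu+\lambda)(a,a+\epsilon)=0,\qquad \lim_{\epsilon\to0+}\big(\partial_v(r\phi)+\partial_u(r\phi)\big)(a,a+\epsilon)=0,$$ $$\lim_{\epsilon\to0+}\sup_{0<\delta\le\epsilon}\mathrm{T.V.}_{(a,a+\delta)\times\{a+\delta\}}[\phi]=\lim_{\epsilon\to0+}\sup_{0<\delta\le\epsilon}\mathrm{T.V.}_{\{a+\delta\}\times(a+\delta,a+\epsilon)}[\phi]=0,$$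 and for every $a>1$ $$\lim_{\epsilon\to0+}\sup_{0<\delta\le\epsilon}\mathrm{T.V.}_{\{a-\delta\}\times(a-\delta,a)}[\phi]=\lim_{\epsilon\to0+}\sup_{0<\delta\le\epsilon}\mathrm{T.V.}_{(a-\epsilon,a-\delta)\times\{a-\delta\}}[\phi]=0 .$$ A BV solution is *locally BV scattering* if (1) $\int_u^\infty\Omega^2(u,v)\,dv=\infty$ for every $u\ge1$ (outgoing radial null geodesics are future complete; the incoming ones end on $\Gamma$); (2) the Bondi mass $M(u)=\lim_{v\to\infty}m(u,v)$ exists for every $u \geq 1$ and $\lim_{u\to\infty}M(u)=0$; (3) for some $R>0$, the total variations of $\partial_v(r\phi)$ and of $\log\lambda$ on $C_u\cap\{r\le R\}$ tend to $0$ as $u\to\infty$. The initial data are *asymptotically flat of order $\omega'>1$ in BV* if $\partial_v(r\phi)(1,\cdot)$ has finite total variation on $[1,\infty)$ and $\sup_{C_1}(1+r)^{\omega'}|\partial_v(r\phi)|<\infty$. **Theorem.** Let $(\phi,r,m)$ be a locally BV scattering solution whose initial data are asymptotically flat of order $\omega'>1$ in BV, and let $\omega=\min\{\omega',3\}$. Then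 there is a constant $A_1>0$ (depending on the solution) such that on $\mathcal Q$ $$|\phi|\le A_1\min\{u^{-\omega},\,r^{-1}u^{-(\omega-1)}\},\qquad |\partial_v(r\phi)|\le A_1\min\{u^{-\omega},\,r^{-\omega}\},\qquad |\partial_u(r\phi)|\le A_1u^{-\omega},$$ where on the axis $r=0$ the first two minima are read as $u^{-\omega}$ and the third bound is asserted off the axis. -/

import Mathlib

open Set Filter Topology MeasureTheory
open scoped ENNReal NNReal

namespace SSESF

/-!
The quotient spacetime is `Q = {(u, v) : 1 ≤ u, u ≤ v}` with axis `Γ = {u = v}` and initial curve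
`C₁ = {u = 1}`. A function on `Q` is written in curried form `f u v`; only its values on `Q` matter.
-/

/-- `∂_v f (u, v)`, as a derivative from the right. If `f u` is absolutely continuous and its almost
everywhere derivative has bounded variation, this is the right-continuous representative of the
distributional derivative. -/
noncomputable def dv (f : ℝ → ℝ → ℝ) (u v : ℝ) : ℝ :=
  derivWithin (fun v' => f u v') (Ioi v) v

/-- `∂_u f (u, v)`, as a derivative from the right; used only at points `u < v`, off the axis. -/
noncomputable def du (f : ℝ → ℝ → ℝ) (u v : ℝ) : ℝ :=
  derivWithin (fun u' => f u' v) (Ioi u) u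

/-- The mass ratio `μ = 2 m / r`. -/
noncomputable def massRatio (r m : ℝ → ℝ → ℝ) (u v : ℝ) : ℝ := 2 * m u v / r u v

/-- The function `Ω²` of the metric `-Ω² du dv + r² ds²_{S²}`, expressed through
`1 - 2 m / r = -4 Ω⁻² ∂_u r ∂_v r`. -/
noncomputable def omegaSq (r m : ℝ → ℝ → ℝ) (u v : ℝ) : ℝ :=
  -4 * du r u v * dv r u v / (1 - massRatio r m u v)

/-- The common right-hand side `μ λ ν / ((1 - μ) r)` of the equations for `∂_u λ` and `∂_v ν`,
with `λ = ∂_v r` and `ν = ∂_u r`. -/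
noncomputable def potential (r m : ℝ → ℝ → ℝ) (u v : ℝ) : ℝ :=
  massRatio r m u v / ((1 - massRatio r m u v) * r u v) * dv r u v * du r u v

/-- `(φ, r, m)` solves the spherically symmetric Einstein–scalar field system on `Q`, in the double
null coordinates normalized by `v = 2 r + 1` on `C₁` and `Γ = {u = v}`. Each equation holds
almost everywhere along every null curve of `Q`, the differentiated quantity being absolutely
continuous along that curve (up to the axis for `r`, `φ` and `m`, and off the axis for the first
derivatives of `r` and of `r φ`). -/
structure IsSolution (φ r m : ℝ → ℝ → ℝ) : Prop where
  r_axis : ∀ u, 1 ≤ u → r u u = 0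
  r_pos : ∀ u v, 1 ≤ u → u < v → 0 < r u v
  r_initial : ∀ v, 1 ≤ v → v = 2 * r 1 v + 1
  m_axis : ∀ u, 1 ≤ u → m u u = 0
  omegaSq_pos : ∀ u v, 1 ≤ u → u < v → 0 < omegaSq r m u v
  r_ac_v : ∀ u v, 1 ≤ u → u ≤ v → AbsolutelyContinuousOnInterval (fun v' => r u v') u v
  r_ac_u : ∀ v, 1 ≤ v → AbsolutelyContinuousOnInterval (fun u' => r u' v) 1 v
  phi_ac_v : ∀ u v, 1 ≤ u → u ≤ v → AbsolutelyContinuousOnInterval (fun v' => φ u v') u v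
  phi_ac_u : ∀ v, 1 ≤ v → AbsolutelyContinuousOnInterval (fun u' => φ u' v) 1 v
  m_ac_v : ∀ u v, 1 ≤ u → u ≤ v → AbsolutelyContinuousOnInterval (fun v' => m u v') u v
  m_ac_u : ∀ v, 1 ≤ v → AbsolutelyContinuousOnInterval (fun u' => m u' v) 1 v
  lam_ac : ∀ u v, 1 ≤ u → u < v → AbsolutelyContinuousOnInterval (fun u' => dv r u' v) 1 u
  nu_ac : ∀ u v₁ v₂, 1 ≤ u → u < v₁ → v₁ ≤ v₂ →
    AbsolutelyContinuousOnInterval (fun v' => du r u v') v₁ v₂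
  dv_rphi_ac : ∀ u v, 1 ≤ u → u < v →
    AbsolutelyContinuousOnInterval (fun u' => dv (r * φ) u' v) 1 u
  du_rphi_ac : ∀ u v₁ v₂, 1 ≤ u → u < v₁ → v₁ ≤ v₂ →
    AbsolutelyContinuousOnInterval (fun v' => du (r * φ) u v') v₁ v₂
  eq_du_lam : ∀ v, 1 < v → ∀ᵐ u, u ∈ Ioo 1 v → du (dv r) u v = potential r m u v
  eq_dv_nu : ∀ u, 1 ≤ u → ∀ᵐ v, v ∈ Ioi u → dv (du r) u v = potential r m u v
  eq_du_m : ∀ v, 1 < v → ∀ᵐ u, u ∈ Ioo 1 v →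
    2 * du r u v * du m u v = (1 - massRatio r m u v) * r u v ^ 2 * du φ u v ^ 2
  eq_dv_m : ∀ u, 1 ≤ u → ∀ᵐ v, v ∈ Ioi u →
    2 * dv r u v * dv m u v = (1 - massRatio r m u v) * r u v ^ 2 * dv φ u v ^ 2
  eq_wave_uv : ∀ v, 1 < v → ∀ᵐ u, u ∈ Ioo 1 v →
    du (dv (r * φ)) u v = potential r m u v * φ u v
  eq_wave_vu : ∀ u, 1 ≤ u → ∀ᵐ v, v ∈ Ioi u →
    dv (du (r * φ)) u v = potential r m u v * φ u v

/-- The regularity required of a solution of bounded variation on the domain of dependence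
`D(u₀, v₀) = {(u, v) : u₀ ≤ u ≤ v ≤ v₀}`. The part of `C_u` in it is `{u} × [u, v₀]`, and the part
of `C̲_v` in it, without the point on the axis, is `[u₀, v) × {v}`. -/
structure IsBVOn (φ r : ℝ → ℝ → ℝ) (u₀ v₀ : ℝ) : Prop where
  neg_nu_bdd : ∃ C : ℝ, ∀ u v, u₀ ≤ u → u < v → v ≤ v₀ → -du r u v ≤ C
  lam_inv_bdd : ∃ C : ℝ, ∀ u v, u₀ ≤ u → u ≤ v → v ≤ v₀ → 0 < dv r u v ∧ (dv r u v)⁻¹ ≤ C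
  lam_bv : ∃ C : ℝ≥0, ∀ u ∈ Icc u₀ v₀, eVariationOn (fun v => dv r u v) (Icc u v₀) ≤ C
  nu_bv : ∃ C : ℝ≥0, ∀ v ∈ Icc u₀ v₀, eVariationOn (fun u => du r u v) (Ico u₀ v) ≤ C
  phi_bv_v : ∃ C : ℝ≥0, ∀ u ∈ Icc u₀ v₀, eVariationOn (fun v => φ u v) (Icc u v₀) ≤ C
  phi_bv_u : ∃ C : ℝ≥0, ∀ v ∈ Icc u₀ v₀, eVariationOn (fun u => φ u v) (Icc u₀ v) ≤ C
  dv_rphi_bv : ∃ C : ℝ≥0, ∀ u ∈ Icc u₀ v₀,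
    eVariationOn (fun v => dv (r * φ) u v) (Icc u v₀) ≤ C
  du_rphi_bv : ∃ C : ℝ≥0, ∀ v ∈ Icc u₀ v₀,
    eVariationOn (fun u => du (r * φ) u v) (Ico u₀ v) ≤ C

/-- Solutions of bounded variation. The conditions `phi_axis_past_*` concern points in the past of
`(a, a)`, which exist in `Q` only for `1 < a`. -/
structure IsBVSolution (φ r m : ℝ → ℝ → ℝ) : Prop extends IsSolution φ r m where
  bv_on : ∀ u₀ v₀, 1 ≤ u₀ → u₀ ≤ v₀ → IsBVOn φ r u₀ v₀
  nu_add_lam_axis : ∀ a, 1 ≤ a →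
    Tendsto (fun ε => du r a (a + ε) + dv r a (a + ε)) (𝓝[>] 0) (𝓝 0)
  phi_axis_past_v : ∀ a, 1 < a →
    Tendsto (fun ε : ℝ => ⨆ δ ∈ Ioc 0 ε,
      eVariationOn (fun v => φ (a - δ) v) (Ioo (a - δ) a)) (𝓝[>] 0) (𝓝 0)
  phi_axis_past_u : ∀ a, 1 < a →
    Tendsto (fun ε : ℝ => ⨆ δ ∈ Ioc 0 ε,
      eVariationOn (fun u => φ u (a - δ)) (Ioo (a - ε) (a - δ))) (𝓝[>] 0) (𝓝 0)
  phi_axis_future_u : ∀ a, 1 ≤ a →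
    Tendsto (fun ε : ℝ => ⨆ δ ∈ Ioc 0 ε,
      eVariationOn (fun u => φ u (a + δ)) (Ioo a (a + δ))) (𝓝[>] 0) (𝓝 0)
  phi_axis_future_v : ∀ a, 1 ≤ a →
    Tendsto (fun ε : ℝ => ⨆ δ ∈ Ioc 0 ε,
      eVariationOn (fun v => φ (a + δ) v) (Ioo (a + δ) (a + ε))) (𝓝[>] 0) (𝓝 0)
  rphi_axis : ∀ a, 1 ≤ a →
    Tendsto (fun ε => dv (r * φ) a (a + ε) + du (r * φ) a (a + ε)) (𝓝[>] 0) (𝓝 0)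

/-- Locally BV scattering solutions. On the global domain `Q` every incoming radial null geodesic
ends on the axis; the affine parameter along the outgoing radial null geodesic `C_u` is
`∫ Ω² dv`. The integrals of `|∂_v² (r φ)|` and `|∂_v log λ|` over `C_u ∩ {r ≤ R}` are the total
variations of `∂_v (r φ)` and of `log λ` there. -/
structure IsLocallyBVScattering (φ r m : ℝ → ℝ → ℝ) : Prop extends IsBVSolution φ r m where
  outgoing_complete : ∀ u, 1 ≤ u → ∫⁻ v in Ioi u, ENNReal.ofReal (omegaSq r m u v) = ∞
  final_bondi_mass : ∃ M : ℝ → ℝ, (∀ u, 1 ≤ u → Tendsto (fun v => m u v) atTop (𝓝 (M u))) ∧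
    Tendsto M atTop (𝓝 0)
  scattering : ∃ R : ℝ, 0 < R ∧
    Tendsto (fun u => eVariationOn (fun v => dv (r * φ) u v) {v | u ≤ v ∧ r u v ≤ R})
      atTop (𝓝 0) ∧
    Tendsto (fun u => eVariationOn (fun v => Real.log (dv r u v)) {v | u ≤ v ∧ r u v ≤ R})
      atTop (𝓝 0)

/-- The initial data on `C₁` are asymptotically flat of order `ω'` in BV. -/
def IsAsymptoticallyFlatBV (φ r : ℝ → ℝ → ℝ) (ω' : ℝ) : Prop :=
  BoundedVariationOn (fun v => dv (r * φ) 1 v) (Ici 1) ∧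
  ∃ I₁ : ℝ, 0 < I₁ ∧ ∀ v, 1 ≤ v → (1 + r 1 v) ^ ω' * |dv (r * φ) 1 v| ≤ I₁

end SSESF

/-
`λ` is nonincreasing in `u`, and completeness together with the scattering condition forces `r → ∞`
on each `C_u` and `λ → 1/2` uniformly as `u → ∞`. In the wave equation
`∂_u ∂_v (r φ) = potential * φ` the potential equals `∂_u λ`, whose integral over late `u` is
therefore small, and away from the axis `potential * φ = O(v⁻³) r φ`.

For bounded `u` the second fact propagates the decay of the initial data in `v`, up to the exponent
`3`; for late `u` the first one closes a bootstrap for `sup |∂_v (r φ)|`. A uniform bound for `ν`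
follows: `∂_v log (-ν)` is governed by `μ λ / r`, whose integral near the axis is controlled by the
local variation of `∂_v (r φ)` and `log λ`. With `ν` bounded, the bootstrap can be repeated for
`sup v ^ ω |∂_v (r φ)|`; integrating from the axis then gives the bounds for `φ` and `∂_u (r φ)`.
-/

namespace SSESF

section AbsolutelyContinuous

variable {f g : ℝ → ℝ} {a b c : ℝ}

theorem ae_hasDerivAt_derivWithin_Ioi (hf : AbsolutelyContinuousOnInterval f a b) :
    ∀ᵐ x, x ∈ uIcc a b → HasDerivAt f (derivWithin f (Ioi x) x) x := by
  filter_upwards [hf.ae_differentiableAt] with x hx hxab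
  have hd := (hx hxab).hasDerivAt
  rwa [hd.hasDerivWithinAt.derivWithin (uniqueDiffWithinAt_Ioi x)]

theorem absolutelyContinuousOnInterval_mono_Icc {a' b' : ℝ}
    (hf : AbsolutelyContinuousOnInterval f a b) (ha : a ≤ a') (hab : a' ≤ b') (hb : b' ≤ b) :
    AbsolutelyContinuousOnInterval f a' b' :=
  hf.mono (by
    rw [uIcc_of_le hab, uIcc_of_le (ha.trans (hab.trans hb))]
    exact Icc_subset_Icc ha hb)

theorem ae_hasDerivAt_derivWithin_of_Ioo
    (h : ∀ a' b', a < a' → a' ≤ b' → b' < b → AbsolutelyContinuousOnInterval f a' b') :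
    ∀ᵐ x, x ∈ Ioo a b → HasDerivAt f (derivWithin f (Ioi x) x) x := by
  have hrat : ∀ᵐ x, ∀ p q : ℚ, a < p → (p : ℝ) ≤ q → (q : ℝ) < b → x ∈ Icc (p : ℝ) q →
      HasDerivAt f (derivWithin f (Ioi x) x) x := by
    simp only [ae_all_iff, eventually_imp_distrib_left]
    intro p q hp hpq hq
    simpa only [uIcc_of_le hpq] using ae_hasDerivAt_derivWithin_Ioi (h p q hp hpq hq)
  filter_upwards [hrat] with x hx hxab
  obtain ⟨p, hap, hpx⟩ := exists_rat_btwn hxab.1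
  obtain ⟨q, hxq, hqb⟩ := exists_rat_btwn hxab.2
  exact hx p q hap (hpx.trans hxq).le hqb ⟨hpx.le, hxq.le⟩

theorem ae_hasDerivAt_derivWithin_of_Ioi
    (h : ∀ a' b', a < a' → a' ≤ b' → AbsolutelyContinuousOnInterval f a' b') :
    ∀ᵐ x, x ∈ Ioi a → HasDerivAt f (derivWithin f (Ioi x) x) x := by
  have hnat : ∀ᵐ x, ∀ n : ℕ, x ∈ Ioo a n → HasDerivAt f (derivWithin f (Ioi x) x) x :=
    ae_all_iff.2 fun n => ae_hasDerivAt_derivWithin_of_Ioo fun a' b' h₁ h₂ _ => h a' b' h₁ h₂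
  filter_upwards [hnat] with x hx hxa
  obtain ⟨n, hn⟩ := exists_nat_gt x
  exact hx n ⟨hxa, hn⟩

theorem le_of_ae_hasDerivAt_nonneg (hab : a ≤ b) (hf : AbsolutelyContinuousOnInterval f a b)
    (h : ∀ᵐ x, x ∈ Ioo a b → ∃ f', HasDerivAt f f' x ∧ 0 ≤ f') : f a ≤ f b := by
  have hint : 0 ≤ ∫ x in a..b, deriv f x := by
    refine intervalIntegral.integral_nonneg_of_ae_restrict hab ?_
    rw [EventuallyLE, ← restrict_Ioo_eq_restrict_Icc, ae_restrict_iff' measurableSet_Ioo]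
    filter_upwards [h] with x hx hxab
    obtain ⟨f', hf', hnonneg⟩ := hx hxab
    rwa [hf'.deriv]
  rwa [hf.integral_deriv_eq_sub, sub_nonneg] at hint

theorem le_of_ae_hasDerivAt_nonpos (hab : a ≤ b) (hf : AbsolutelyContinuousOnInterval f a b)
    (h : ∀ᵐ x, x ∈ Ioo a b → ∃ f', HasDerivAt f f' x ∧ f' ≤ 0) : f b ≤ f a := by
  refine neg_le_neg_iff.1 (le_of_ae_hasDerivAt_nonneg (f := fun x => -f x) hab hf.fun_neg ?_)
  filter_upwards [h] with x hx hxab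
  obtain ⟨f', hf', hnonpos⟩ := hx hxab
  exact ⟨-f', hf'.fun_neg, neg_nonneg.2 hnonpos⟩

theorem sub_le_sub_of_ae_hasDerivAt_le (hab : a ≤ b) (hf : AbsolutelyContinuousOnInterval f a b)
    (hg : AbsolutelyContinuousOnInterval g a b)
    (h : ∀ᵐ x, x ∈ Ioo a b → ∃ f' g', HasDerivAt f f' x ∧ HasDerivAt g g' x ∧ f' ≤ g') :
    f b - f a ≤ g b - g a := by
  have hmono : g a - f a ≤ g b - f b := by
    refine le_of_ae_hasDerivAt_nonneg (f := fun x => g x - f x) hab (hg.fun_sub hf) ?_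
    filter_upwards [h] with x hx hxab
    obtain ⟨f', g', hf', hg', hle⟩ := hx hxab
    exact ⟨g' - f', hg'.fun_sub hf', sub_nonneg.2 hle⟩
  linarith

theorem abs_sub_le_sub_of_ae_hasDerivAt (hab : a ≤ b) (hf : AbsolutelyContinuousOnInterval f a b)
    (hg : AbsolutelyContinuousOnInterval g a b)
    (h : ∀ᵐ x, x ∈ Ioo a b → ∃ f' g', HasDerivAt f f' x ∧ HasDerivAt g g' x ∧ |f'| ≤ g') :
    |f b - f a| ≤ g b - g a := by
  have hpos := sub_le_sub_of_ae_hasDerivAt_le hab hf hg <| by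
    filter_upwards [h] with x hx hxab
    obtain ⟨f', g', hf', hg', hle⟩ := hx hxab
    exact ⟨f', g', hf', hg', (le_abs_self f').trans hle⟩
  have hneg := sub_le_sub_of_ae_hasDerivAt_le (f := fun x => -f x) hab hf.fun_neg hg <| by
    filter_upwards [h] with x hx hxab
    obtain ⟨f', g', hf', hg', hle⟩ := hx hxab
    exact ⟨-f', g', hf'.fun_neg, hg', (neg_le_abs f').trans hle⟩
  rw [abs_le]
  constructor <;> linarith

theorem nonpos_of_ae_hasDerivAt_nonpos_of_pos (hab : a ≤ b)
    (hf : AbsolutelyContinuousOnInterval f a b) (ha : f a ≤ 0)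
    (h : ∀ᵐ x, x ∈ Ioo a b → 0 < f x → ∃ f', HasDerivAt f f' x ∧ f' ≤ 0) : f b ≤ 0 := by
  have hcont : ContinuousOn f (Icc a b) := uIcc_of_le hab ▸ hf.continuousOn
  have hclosed : IsClosed (Icc a b ∩ f ⁻¹' Iic 0) :=
    hcont.preimage_isClosed_of_isClosed isClosed_Icc isClosed_Iic
  -- `f` is positive, hence nonincreasing, after its last zero `w`
  obtain ⟨w, ⟨hw, hfw : f w ≤ 0⟩, hmax⟩ := (isCompact_Icc.of_isClosed_subset hclosed
    inter_subset_left).exists_isGreatest ⟨a, ⟨le_rfl, hab⟩, ha⟩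
  refine (le_of_ae_hasDerivAt_nonpos hw.2
    (absolutelyContinuousOnInterval_mono_Icc hf hw.1 hw.2 le_rfl) ?_).trans hfw
  filter_upwards [h] with x hx hxw
  refine hx ⟨hw.1.trans_lt hxw.1, hxw.2⟩ (not_le.1 fun hfx => ?_)
  exact hxw.1.not_ge (hmax ⟨⟨hw.1.trans hxw.1.le, hxw.2.le⟩, hfx⟩)

theorem absolutelyContinuousOnInterval_lipschitzOnWith_comp {F : ℝ → ℝ} {s : Set ℝ} {K : ℝ≥0}
    (hF : LipschitzOnWith K F s) (hf : AbsolutelyContinuousOnInterval f a b)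
    (hs : MapsTo f (uIcc a b) s) : AbsolutelyContinuousOnInterval (fun x => F (f x)) a b := by
  unfold AbsolutelyContinuousOnInterval at hf ⊢
  refine squeeze_zero' (Eventually.of_forall fun _ => Finset.sum_nonneg fun _ _ => dist_nonneg) ?_
    (by simpa using hf.const_mul (K : ℝ))
  rw [eventually_inf_principal]
  filter_upwards with E hE
  rw [Finset.mul_sum]
  exact Finset.sum_le_sum fun i hi =>
    hF.dist_le_mul _ (hs (hE.1 i hi).1) _ (hs (hE.1 i hi).2)

theorem absolutelyContinuousOnInterval_contDiffOn_comp {F : ℝ → ℝ}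
    (hF : ContDiffOn ℝ 1 F (Ioi 0)) (hf : AbsolutelyContinuousOnInterval f a b)
    (hpos : ∀ x ∈ uIcc a b, 0 < f x) : AbsolutelyContinuousOnInterval (fun x => F (f x)) a b := by
  obtain ⟨x₀, hx₀, hmin⟩ := isCompact_uIcc.exists_isMinOn nonempty_uIcc hf.continuousOn
  obtain ⟨x₁, -, hmax⟩ := isCompact_uIcc.exists_isMaxOn nonempty_uIcc hf.continuousOn
  have hsub : Icc (f x₀) (f x₁) ⊆ Ioi 0 := fun y hy => (hpos x₀ hx₀).trans_le hy.1
  obtain ⟨K, hK⟩ := (hF.mono hsub).exists_lipschitzOnWith one_ne_zero (convex_Icc _ _)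
    isCompact_Icc
  exact absolutelyContinuousOnInterval_lipschitzOnWith_comp hK hf fun x hx => ⟨hmin hx, hmax hx⟩

theorem absolutelyContinuousOnInterval_log (hf : AbsolutelyContinuousOnInterval f a b)
    (hpos : ∀ x ∈ uIcc a b, 0 < f x) :
    AbsolutelyContinuousOnInterval (fun x => Real.log (f x)) a b :=
  absolutelyContinuousOnInterval_contDiffOn_comp
    (fun _ hx => (Real.contDiffAt_log.2 (ne_of_gt hx)).contDiffWithinAt) hf hpos

theorem absolutelyContinuousOnInterval_inv (hf : AbsolutelyContinuousOnInterval f a b)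
    (hpos : ∀ x ∈ uIcc a b, 0 < f x) : AbsolutelyContinuousOnInterval (fun x => (f x)⁻¹) a b :=
  absolutelyContinuousOnInterval_contDiffOn_comp
    (fun _ hx => (contDiffAt_inv ℝ (ne_of_gt hx)).contDiffWithinAt) hf hpos

theorem absolutelyContinuousOnInterval_id (a b : ℝ) :
    AbsolutelyContinuousOnInterval (fun x => x) a b :=
  contDiff_id.contDiffOn.absolutelyContinuousOnInterval

theorem absolutelyContinuousOnInterval_rpow (p : ℝ) (ha : 0 < a) (hab : a ≤ b) :
    AbsolutelyContinuousOnInterval (fun s : ℝ => s ^ p) a b :=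
  absolutelyContinuousOnInterval_contDiffOn_comp (F := fun s : ℝ => s ^ p)
    (fun _ hx => (Real.contDiffAt_rpow_const_of_ne (ne_of_gt hx)).contDiffWithinAt)
    (absolutelyContinuousOnInterval_id a b)
    fun x hx => by rw [uIcc_of_le hab] at hx; exact ha.trans_le hx.1

theorem lintegral_derivWithin_Ioi_eq (hab : a ≤ b) (hf : AbsolutelyContinuousOnInterval f a b)
    (h : ∀ x ∈ Ioc a b, 0 ≤ derivWithin f (Ioi x) x) :
    ∫⁻ x in Ioc a b, ENNReal.ofReal (derivWithin f (Ioi x) x) = ENNReal.ofReal (f b - f a) := by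
  have hae : deriv f =ᵐ[volume.restrict (Ioc a b)] fun x => derivWithin f (Ioi x) x := by
    rw [EventuallyEq, ae_restrict_iff' measurableSet_Ioc]
    filter_upwards [ae_hasDerivAt_derivWithin_Ioi hf] with x hx hxab
    exact (hx (uIcc_of_le hab ▸ Ioc_subset_Icc_self hxab)).deriv
  have hint : Integrable (fun x => derivWithin f (Ioi x) x) (volume.restrict (Ioc a b)) :=
    ((intervalIntegrable_iff_integrableOn_Ioc_of_le hab).1 hf.intervalIntegrable_deriv).congr hae
  have hnonneg : 0 ≤ᵐ[volume.restrict (Ioc a b)] fun x => derivWithin f (Ioi x) x :=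
    (ae_restrict_iff' measurableSet_Ioc).2 (Eventually.of_forall h)
  rw [← hf.integral_deriv_eq_sub, intervalIntegral.integral_of_le hab, integral_congr_ae hae,
    ofReal_integral_eq_lintegral_ofReal hint hnonneg]

theorem lintegral_Ioi_le_of_forall_Ioc {f : ℝ → ℝ≥0∞} {C : ℝ≥0∞}
    (h : ∀ b, a ≤ b → ∫⁻ x in Ioc a b, f x ≤ C) : ∫⁻ x in Ioi a, f x ≤ C := by
  have hunion : Ioi a = ⋃ n : ℕ, Ioc a (a + n) := by
    ext x
    simp only [mem_Ioi, mem_iUnion, mem_Ioc]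
    refine ⟨fun hx => ?_, fun ⟨_, hn⟩ => hn.1⟩
    obtain ⟨n, hn⟩ := exists_nat_ge (x - a)
    exact ⟨n, hx, by linarith⟩
  rw [hunion, setLIntegral_iUnion_of_directed]
  · exact iSup_le fun n => h _ (le_add_of_nonneg_right n.cast_nonneg)
  · exact Monotone.directed_le fun n k hnk => Ioc_subset_Ioc_right (by gcongr)

theorem hasDerivAt_neg_rpow_one_sub_div {p s : ℝ} (hp : 1 < p) (hs : 0 < s) :
    HasDerivAt (fun s : ℝ => -(s ^ (1 - p) / (p - 1))) (s ^ (-p)) s := by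
  have hderiv :=
    ((Real.hasDerivAt_rpow_const (p := 1 - p) (Or.inl hs.ne')).div_const (p - 1)).fun_neg
  have hp1 : p - 1 ≠ 0 := by linarith
  have hvalue : -((1 - p) * s ^ (1 - p - 1) / (p - 1)) = s ^ (-p) := by
    rw [show 1 - p - 1 = -p by ring]
    field_simp
    ring
  rwa [hvalue] at hderiv

end AbsolutelyContinuous

theorem abs_sub_le_of_eVariationOn_le {f : ℝ → ℝ} {s : Set ℝ} {δ x y : ℝ} (hδ : 0 ≤ δ)
    (h : eVariationOn f s ≤ ENNReal.ofReal δ) (hx : x ∈ s) (hy : y ∈ s) : |f x - f y| ≤ δ := by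
  have hedist := (eVariationOn.edist_le f hx hy).trans h
  rwa [edist_dist, ENNReal.ofReal_le_ofReal_iff hδ] at hedist

theorem le_two_mul_of_improvable {α : Type*} {s : Set α} {f : α → ℝ} {C : ℝ}
    (hb : BddAbove (f '' s)) (h : ∀ X, (∀ x ∈ s, f x ≤ X) → ∀ x ∈ s, f x ≤ C + X / 2) {x : α}
    (hx : x ∈ s) : f x ≤ 2 * C := by
  have hsup : ∀ y ∈ s, f y ≤ sSup (f '' s) := fun y hy => le_csSup hb (mem_image_of_mem f hy)
  have himp : sSup (f '' s) ≤ C + sSup (f '' s) / 2 :=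
    csSup_le ⟨f x, mem_image_of_mem f hx⟩ (forall_mem_image.2 (h _ hsup))
  linarith [hsup x hx]

/-- Solutions for which `-∂_u r`, `(∂_v r)⁻¹`, `φ` and `∂_v (r φ)` are locally bounded off the axis
and the two boundary conditions at the axis on first derivatives hold. This is what the decay
estimates use of a solution of bounded variation. -/
structure IsLocallyBoundedSolution (φ r m : ℝ → ℝ → ℝ) : Prop extends IsSolution φ r m where
  neg_nu_bdd : ∀ V, ∃ C : ℝ, ∀ u v, 1 ≤ u → u < v → v ≤ V → -du r u v ≤ C
  lam_bdd_below : ∀ V, ∃ c : ℝ, 0 < c ∧ ∀ u v, 1 ≤ u → u < v → v ≤ V → c ≤ dv r u v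
  phi_bdd : ∀ V, ∃ C : ℝ, ∀ u v, 1 ≤ u → u < v → v ≤ V → |φ u v| ≤ C
  dv_rphi_bdd : ∀ u V, 1 ≤ u → ∃ C : ℝ, ∀ v, u < v → v ≤ V → |dv (r * φ) u v| ≤ C
  nu_add_lam_axis : ∀ a, 1 ≤ a →
    Tendsto (fun ε => du r a (a + ε) + dv r a (a + ε)) (𝓝[>] 0) (𝓝 0)
  rphi_axis : ∀ a, 1 ≤ a →
    Tendsto (fun ε => dv (r * φ) a (a + ε) + du (r * φ) a (a + ε)) (𝓝[>] 0) (𝓝 0)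

/-- The scattering conditions of `IsLocallyBVScattering`, imposed on a locally bounded solution
which need not have bounded variation. -/
structure IsLocallyBoundedScattering (φ r m : ℝ → ℝ → ℝ) : Prop
    extends IsLocallyBoundedSolution φ r m where
  outgoing_complete : ∀ u, 1 ≤ u → ∫⁻ v in Ioi u, ENNReal.ofReal (omegaSq r m u v) = ∞
  final_bondi_mass : ∃ M : ℝ → ℝ, (∀ u, 1 ≤ u → Tendsto (fun v => m u v) atTop (𝓝 (M u))) ∧
    Tendsto M atTop (𝓝 0)
  scattering : ∃ R : ℝ, 0 < R ∧
    Tendsto (fun u => eVariationOn (fun v => dv (r * φ) u v) {v | u ≤ v ∧ r u v ≤ R})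
      atTop (𝓝 0) ∧
    Tendsto (fun u => eVariationOn (fun v => Real.log (dv r u v)) {v | u ≤ v ∧ r u v ≤ R})
      atTop (𝓝 0)

variable {φ r m : ℝ → ℝ → ℝ} {u u₁ u₂ v v₁ v₂ U V M C D F H I K R X l p δ ε ρ ω : ℝ}

theorem abs_le_add_of_eVariationOn_le {f : ℝ → ℝ} {s : Set ℝ} {C : ℝ≥0} {x y : ℝ}
    (h : eVariationOn f s ≤ C) (hx : x ∈ s) (hy : y ∈ s) : |f x| ≤ |f y| + C := by
  rw [← ENNReal.ofReal_coe_nnreal] at h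
  linarith [abs_sub_le_of_eVariationOn_le C.coe_nonneg h hx hy, abs_sub_abs_le_abs_sub (f x) (f y)]

theorem IsBVOn.exists_lam_ge (h : IsBVOn φ r 1 V) :
    ∃ c : ℝ, 0 < c ∧ ∀ u v, 1 ≤ u → u < v → v ≤ V → c ≤ dv r u v := by
  obtain ⟨C, hC⟩ := h.lam_inv_bdd
  refine ⟨(max C 1)⁻¹, by positivity, fun u v hu huv hv => ?_⟩
  obtain ⟨hpos, hinv⟩ := hC u v hu huv.le hv
  exact inv_le_of_inv_le₀ hpos (hinv.trans (le_max_left _ _))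

theorem IsBVOn.exists_abs_phi_le (h : IsBVOn φ r 1 V) :
    ∃ C : ℝ, ∀ u v, 1 ≤ u → u < v → v ≤ V → |φ u v| ≤ C := by
  obtain ⟨C₁, hC₁⟩ := h.phi_bv_v
  obtain ⟨C₂, hC₂⟩ := h.phi_bv_u
  refine ⟨|φ 1 1| + C₁ + C₂, fun u v hu huv hv => ?_⟩
  have hV : 1 ≤ V := by linarith
  have hinitial : |φ 1 v| ≤ |φ 1 1| + C₁ := abs_le_add_of_eVariationOn_le (hC₁ 1 ⟨le_rfl, hV⟩)
    ⟨by linarith, hv⟩ ⟨le_rfl, hV⟩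
  have hincoming : |φ u v| ≤ |φ 1 v| + C₂ :=
    abs_le_add_of_eVariationOn_le (f := fun u => φ u v) (hC₂ v ⟨by linarith, hv⟩)
      ⟨hu, huv.le⟩ ⟨le_rfl, by linarith⟩
  linarith

theorem IsBVOn.exists_abs_dv_rphi_le (h : IsBVOn φ r u V) :
    ∃ C : ℝ, ∀ v, u < v → v ≤ V → |dv (r * φ) u v| ≤ C := by
  obtain ⟨C, hC⟩ := h.dv_rphi_bv
  refine ⟨|dv (r * φ) u u| + C, fun v huv hv => ?_⟩
  have hV : u ≤ V := huv.le.trans hv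
  exact abs_le_add_of_eVariationOn_le (hC u ⟨le_rfl, hV⟩) ⟨huv.le, hv⟩ ⟨le_rfl, hV⟩

theorem IsBVSolution.isLocallyBoundedSolution (h : IsBVSolution φ r m) :
    IsLocallyBoundedSolution φ r m where
  toIsSolution := h.toIsSolution
  neg_nu_bdd V := by
    obtain ⟨C, hC⟩ := (h.bv_on 1 (max V 1) le_rfl (le_max_right _ _)).neg_nu_bdd
    exact ⟨C, fun u v hu huv hv => hC u v hu huv (hv.trans (le_max_left _ _))⟩
  lam_bdd_below V := by
    obtain ⟨c, hc, hlam⟩ := (h.bv_on 1 (max V 1) le_rfl (le_max_right _ _)).exists_lam_ge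
    exact ⟨c, hc, fun u v hu huv hv => hlam u v hu huv (hv.trans (le_max_left _ _))⟩
  phi_bdd V := by
    obtain ⟨C, hC⟩ := (h.bv_on 1 (max V 1) le_rfl (le_max_right _ _)).exists_abs_phi_le
    exact ⟨C, fun u v hu huv hv => hC u v hu huv (hv.trans (le_max_left _ _))⟩
  dv_rphi_bdd u V hu := by
    obtain ⟨C, hC⟩ := (h.bv_on u (max V u) hu (le_max_right _ _)).exists_abs_dv_rphi_le
    exact ⟨C, fun v huv hv => hC v huv (hv.trans (le_max_left _ _))⟩
  nu_add_lam_axis := h.nu_add_lam_axis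
  rphi_axis := h.rphi_axis

theorem IsLocallyBVScattering.isLocallyBoundedScattering (h : IsLocallyBVScattering φ r m) :
    IsLocallyBoundedScattering φ r m where
  toIsLocallyBoundedSolution := h.isLocallyBoundedSolution
  outgoing_complete := h.outgoing_complete
  final_bondi_mass := h.final_bondi_mass
  scattering := h.scattering

namespace IsSolution

theorem r_ac_v_of_le (h : IsSolution φ r m) (hu : 1 ≤ u) (h₁ : u ≤ v₁) (h₂ : v₁ ≤ v₂) :
    AbsolutelyContinuousOnInterval (fun v => r u v) v₁ v₂ :=
  absolutelyContinuousOnInterval_mono_Icc (h.r_ac_v u v₂ hu (h₁.trans h₂)) h₁ h₂ le_rfl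

theorem phi_ac_v_of_le (h : IsSolution φ r m) (hu : 1 ≤ u) (h₁ : u ≤ v₁) (h₂ : v₁ ≤ v₂) :
    AbsolutelyContinuousOnInterval (fun v => φ u v) v₁ v₂ :=
  absolutelyContinuousOnInterval_mono_Icc (h.phi_ac_v u v₂ hu (h₁.trans h₂)) h₁ h₂ le_rfl

theorem m_ac_v_of_le (h : IsSolution φ r m) (hu : 1 ≤ u) (h₁ : u ≤ v₁) (h₂ : v₁ ≤ v₂) :
    AbsolutelyContinuousOnInterval (fun v => m u v) v₁ v₂ :=
  absolutelyContinuousOnInterval_mono_Icc (h.m_ac_v u v₂ hu (h₁.trans h₂)) h₁ h₂ le_rfl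

theorem rphi_ac_v_of_le (h : IsSolution φ r m) (hu : 1 ≤ u) (h₁ : u ≤ v₁) (h₂ : v₁ ≤ v₂) :
    AbsolutelyContinuousOnInterval (fun v => (r * φ) u v) v₁ v₂ :=
  (h.r_ac_v_of_le hu h₁ h₂).fun_mul (h.phi_ac_v_of_le hu h₁ h₂)

theorem r_ac_u_of_le (h : IsSolution φ r m) (hu : 1 ≤ u₁) (h₁ : u₁ ≤ u₂) (h₂ : u₂ ≤ v) :
    AbsolutelyContinuousOnInterval (fun u => r u v) u₁ u₂ :=
  absolutelyContinuousOnInterval_mono_Icc (h.r_ac_u v (hu.trans (h₁.trans h₂))) hu h₁ h₂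

theorem m_ac_u_of_le (h : IsSolution φ r m) (hu : 1 ≤ u₁) (h₁ : u₁ ≤ u₂) (h₂ : u₂ ≤ v) :
    AbsolutelyContinuousOnInterval (fun u => m u v) u₁ u₂ :=
  absolutelyContinuousOnInterval_mono_Icc (h.m_ac_u v (hu.trans (h₁.trans h₂))) hu h₁ h₂

theorem lam_ac_of_le (h : IsSolution φ r m) (hu : 1 ≤ u₁) (h₁ : u₁ ≤ u₂) (h₂ : u₂ < v) :
    AbsolutelyContinuousOnInterval (fun u => dv r u v) u₁ u₂ :=
  absolutelyContinuousOnInterval_mono_Icc (h.lam_ac u₂ v (hu.trans h₁) h₂) hu h₁ le_rfl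

theorem dv_rphi_ac_of_le (h : IsSolution φ r m) (hu : 1 ≤ u₁) (h₁ : u₁ ≤ u₂) (h₂ : u₂ < v) :
    AbsolutelyContinuousOnInterval (fun u => dv (r * φ) u v) u₁ u₂ :=
  absolutelyContinuousOnInterval_mono_Icc (h.dv_rphi_ac u₂ v (hu.trans h₁) h₂) hu h₁ le_rfl

theorem ae_hasDerivAt_r_v (h : IsSolution φ r m) (hu : 1 ≤ u) :
    ∀ᵐ v, v ∈ Ioi u → HasDerivAt (fun v' => r u v') (dv r u v) v :=
  ae_hasDerivAt_derivWithin_of_Ioi fun _ _ h₁ h₂ => h.r_ac_v_of_le hu h₁.le h₂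

theorem ae_hasDerivAt_phi_v (h : IsSolution φ r m) (hu : 1 ≤ u) :
    ∀ᵐ v, v ∈ Ioi u → HasDerivAt (fun v' => φ u v') (dv φ u v) v :=
  ae_hasDerivAt_derivWithin_of_Ioi fun _ _ h₁ h₂ => h.phi_ac_v_of_le hu h₁.le h₂

theorem ae_hasDerivAt_m_v (h : IsSolution φ r m) (hu : 1 ≤ u) :
    ∀ᵐ v, v ∈ Ioi u → HasDerivAt (fun v' => m u v') (dv m u v) v :=
  ae_hasDerivAt_derivWithin_of_Ioi fun _ _ h₁ h₂ => h.m_ac_v_of_le hu h₁.le h₂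

theorem ae_hasDerivAt_rphi_v (h : IsSolution φ r m) (hu : 1 ≤ u) :
    ∀ᵐ v, v ∈ Ioi u → HasDerivAt (fun v' => (r * φ) u v') (dv (r * φ) u v) v :=
  ae_hasDerivAt_derivWithin_of_Ioi fun _ _ h₁ h₂ => h.rphi_ac_v_of_le hu h₁.le h₂

theorem ae_hasDerivAt_nu_v (h : IsSolution φ r m) (hu : 1 ≤ u) :
    ∀ᵐ v, v ∈ Ioi u → HasDerivAt (fun v' => du r u v') (potential r m u v) v := by
  filter_upwards [h.eq_dv_nu u hu, ae_hasDerivAt_derivWithin_of_Ioi fun v₁ v₂ h₁ h₂ =>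
    h.nu_ac u v₁ v₂ hu h₁ h₂] with v heq hderiv hv
  exact heq hv ▸ hderiv hv

theorem ae_hasDerivAt_du_rphi_v (h : IsSolution φ r m) (hu : 1 ≤ u) :
    ∀ᵐ v, v ∈ Ioi u →
      HasDerivAt (fun v' => du (r * φ) u v') (potential r m u v * φ u v) v := by
  filter_upwards [h.eq_wave_vu u hu, ae_hasDerivAt_derivWithin_of_Ioi fun v₁ v₂ h₁ h₂ =>
    h.du_rphi_ac u v₁ v₂ hu h₁ h₂] with v heq hderiv hv
  exact heq hv ▸ hderiv hv

theorem ae_hasDerivAt_r_u (h : IsSolution φ r m) :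
    ∀ᵐ u, u ∈ Ioo 1 v → HasDerivAt (fun u' => r u' v) (du r u v) u :=
  ae_hasDerivAt_derivWithin_of_Ioo fun _ _ h₁ h₂ h₃ => h.r_ac_u_of_le h₁.le h₂ h₃.le

theorem ae_hasDerivAt_m_u (h : IsSolution φ r m) :
    ∀ᵐ u, u ∈ Ioo 1 v → HasDerivAt (fun u' => m u' v) (du m u v) u :=
  ae_hasDerivAt_derivWithin_of_Ioo fun _ _ h₁ h₂ h₃ => h.m_ac_u_of_le h₁.le h₂ h₃.le

theorem ae_hasDerivAt_lam_u (h : IsSolution φ r m) (hv : 1 < v) :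
    ∀ᵐ u, u ∈ Ioo 1 v → HasDerivAt (fun u' => dv r u' v) (potential r m u v) u := by
  filter_upwards [h.eq_du_lam v hv, ae_hasDerivAt_derivWithin_of_Ioo fun u₁ u₂ h₁ h₂ h₃ =>
    h.lam_ac_of_le h₁.le h₂ h₃] with u heq hderiv hu
  exact heq hu ▸ hderiv hu

theorem ae_hasDerivAt_dv_rphi_u (h : IsSolution φ r m) (hv : 1 < v) :
    ∀ᵐ u, u ∈ Ioo 1 v →
      HasDerivAt (fun u' => dv (r * φ) u' v) (potential r m u v * φ u v) u := by
  filter_upwards [h.eq_wave_uv v hv, ae_hasDerivAt_derivWithin_of_Ioo fun u₁ u₂ h₁ h₂ h₃ =>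
    h.dv_rphi_ac_of_le h₁.le h₂ h₃] with u heq hderiv hu
  exact heq hu ▸ hderiv hu

theorem nu_ne_zero (h : IsSolution φ r m) (hu : 1 ≤ u) (huv : u < v) : du r u v ≠ 0 := by
  intro h0
  have hpos := h.omegaSq_pos u v hu huv
  simp [omegaSq, h0] at hpos

theorem lam_initial (h : IsSolution φ r m) (hv : 1 ≤ v) : dv r 1 v = 1 / 2 := by
  have hlinear : HasDerivWithinAt (fun v' : ℝ => (v' - 1) / 2) (1 / 2) (Ioi v) v :=
    (((hasDerivAt_id v).sub_const 1).div_const 2).hasDerivWithinAt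
  have hr : HasDerivWithinAt (fun v' : ℝ => r 1 v') (1 / 2) (Ioi v) v := by
    refine hlinear.congr (fun x hx => ?_) ?_
    · linarith [h.r_initial x (hv.trans (le_of_lt hx))]
    · linarith [h.r_initial v hv]
  exact hr.derivWithin (uniqueDiffWithinAt_Ioi v)

end IsSolution

namespace IsLocallyBoundedSolution

theorem lam_pos (h : IsLocallyBoundedSolution φ r m) (hu : 1 ≤ u) (huv : u < v) :
    0 < dv r u v := by
  obtain ⟨c, hc, hlam⟩ := h.lam_bdd_below v
  exact hc.trans_le (hlam u v hu huv le_rfl)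

theorem nu_neg_near_axis (h : IsLocallyBoundedSolution φ r m) (hu : 1 ≤ u) :
    ∀ᶠ ε in 𝓝[>] (0 : ℝ), du r u (u + ε) < 0 := by
  obtain ⟨c, hc, hlam⟩ := h.lam_bdd_below (u + 1)
  filter_upwards [(h.nu_add_lam_axis u hu).eventually (gt_mem_nhds hc),
    Ioo_mem_nhdsGT one_pos] with ε hsum hε
  linarith [hlam u (u + ε) hu (by linarith [hε.1]) (by linarith [hε.2])]

theorem nu_neg (h : IsLocallyBoundedSolution φ r m) (hu : 1 ≤ u) (huv : u < v) :
    du r u v < 0 := by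
  obtain ⟨ε, hneg, hε, hεv⟩ := ((h.nu_neg_near_axis hu).and
    (Ioo_mem_nhdsGT (sub_pos.2 huv))).exists
  have hle : u + ε ≤ v := by linarith
  by_contra hnonneg
  have hcont := (h.nu_ac u (u + ε) v hu (by linarith) hle).continuousOn
  rw [uIcc_of_le hle] at hcont
  obtain ⟨w, hw, hw0⟩ := intermediate_value_Icc hle hcont ⟨hneg.le, not_lt.1 hnonneg⟩
  exact h.nu_ne_zero hu (by linarith [hw.1]) hw0

theorem one_sub_massRatio_pos (h : IsLocallyBoundedSolution φ r m) (hu : 1 ≤ u) (huv : u < v) :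
    0 < 1 - massRatio r m u v := by
  have hnum : 0 < -4 * du r u v * dv r u v :=
    mul_pos (by linarith [h.nu_neg hu huv]) (h.lam_pos hu huv)
  exact (div_pos_iff_of_pos_left hnum).1 (h.omegaSq_pos u v hu huv)

theorem ae_dv_m_nonneg (h : IsLocallyBoundedSolution φ r m) (hu : 1 ≤ u) :
    ∀ᵐ v, v ∈ Ioi u → 0 ≤ dv m u v := by
  filter_upwards [h.eq_dv_m u hu] with v heq hv
  have hlam := h.lam_pos hu hv
  have hμ := h.one_sub_massRatio_pos hu hv
  have hprod : 0 ≤ 2 * dv r u v * dv m u v := by rw [heq hv]; positivity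
  exact nonneg_of_mul_nonneg_right hprod (by positivity)

theorem m_mono_v (h : IsLocallyBoundedSolution φ r m) (hu : 1 ≤ u) (h₁ : u ≤ v₁) (h₂ : v₁ ≤ v₂) :
    m u v₁ ≤ m u v₂ := by
  refine le_of_ae_hasDerivAt_nonneg h₂ (h.m_ac_v_of_le hu h₁ h₂) ?_
  filter_upwards [h.ae_dv_m_nonneg hu, h.ae_hasDerivAt_m_v hu] with v hnonneg hderiv hv
  have huv := h₁.trans_lt hv.1
  exact ⟨_, hderiv huv, hnonneg huv⟩

theorem m_nonneg (h : IsLocallyBoundedSolution φ r m) (hu : 1 ≤ u) (huv : u ≤ v) : 0 ≤ m u v := by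
  rw [← h.m_axis u hu]
  exact h.m_mono_v hu le_rfl huv

theorem m_anti_u (h : IsLocallyBoundedSolution φ r m) (hu : 1 ≤ u₁) (h₁ : u₁ ≤ u₂) (h₂ : u₂ ≤ v) :
    m u₂ v ≤ m u₁ v := by
  rcases h₁.eq_or_lt with rfl | h₁'
  · exact le_rfl
  refine le_of_ae_hasDerivAt_nonpos (f := fun u => m u v) h₁ (h.m_ac_u_of_le hu h₁ h₂) ?_
  filter_upwards [h.eq_du_m v (by linarith), h.ae_hasDerivAt_m_u] with u heq hderiv hu'
  have hmem : u ∈ Ioo 1 v := ⟨hu.trans_lt hu'.1, hu'.2.trans_le h₂⟩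
  refine ⟨_, hderiv hmem, ?_⟩
  have hnu := h.nu_neg hmem.1.le hmem.2
  have hμ := h.one_sub_massRatio_pos hmem.1.le hmem.2
  have hprod : 0 ≤ 2 * du r u v * du m u v := by rw [heq hmem]; positivity
  exact nonpos_of_mul_nonneg_right hprod (by linarith)

theorem massRatio_nonneg (h : IsLocallyBoundedSolution φ r m) (hu : 1 ≤ u) (huv : u < v) :
    0 ≤ massRatio r m u v :=
  div_nonneg (by linarith [h.m_nonneg hu huv.le]) (h.r_pos u v hu huv).le

theorem potential_nonpos (h : IsLocallyBoundedSolution φ r m) (hu : 1 ≤ u) (huv : u < v) :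
    potential r m u v ≤ 0 := by
  have hμ := h.massRatio_nonneg hu huv
  have hμ' := h.one_sub_massRatio_pos hu huv
  have hr := h.r_pos u v hu huv
  have hlam := h.lam_pos hu huv
  exact mul_nonpos_of_nonneg_of_nonpos (by positivity) (h.nu_neg hu huv).le

theorem r_mono_v (h : IsLocallyBoundedSolution φ r m) (hu : 1 ≤ u) (h₁ : u ≤ v₁) (h₂ : v₁ ≤ v₂) :
    r u v₁ ≤ r u v₂ := by
  refine le_of_ae_hasDerivAt_nonneg h₂ (h.r_ac_v_of_le hu h₁ h₂) ?_
  filter_upwards [h.ae_hasDerivAt_r_v hu] with v hderiv hv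
  have huv := h₁.trans_lt hv.1
  exact ⟨_, hderiv huv, (h.lam_pos hu huv).le⟩

theorem r_nonneg (h : IsLocallyBoundedSolution φ r m) (hu : 1 ≤ u) (huv : u ≤ v) : 0 ≤ r u v := by
  rw [← h.r_axis u hu]
  exact h.r_mono_v hu le_rfl huv

theorem r_anti_u (h : IsLocallyBoundedSolution φ r m) (hu : 1 ≤ u₁) (h₁ : u₁ ≤ u₂) (h₂ : u₂ ≤ v) :
    r u₂ v ≤ r u₁ v := by
  refine le_of_ae_hasDerivAt_nonpos (f := fun u => r u v) h₁ (h.r_ac_u_of_le hu h₁ h₂) ?_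
  filter_upwards [h.ae_hasDerivAt_r_u] with u hderiv hu'
  have hmem : u ∈ Ioo 1 v := ⟨hu.trans_lt hu'.1, hu'.2.trans_le h₂⟩
  exact ⟨_, hderiv hmem, (h.nu_neg hmem.1.le hmem.2).le⟩

theorem lam_anti (h : IsLocallyBoundedSolution φ r m) (hu : 1 ≤ u₁) (h₁ : u₁ ≤ u₂) (h₂ : u₂ < v) :
    dv r u₂ v ≤ dv r u₁ v := by
  refine le_of_ae_hasDerivAt_nonpos (f := fun u => dv r u v) h₁ (h.lam_ac_of_le hu h₁ h₂) ?_
  filter_upwards [h.ae_hasDerivAt_lam_u (by linarith)] with u hderiv hu'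
  have hmem : u ∈ Ioo 1 v := ⟨hu.trans_lt hu'.1, hu'.2.trans h₂⟩
  exact ⟨_, hderiv hmem, h.potential_nonpos hmem.1.le hmem.2⟩

theorem lam_le_half (h : IsLocallyBoundedSolution φ r m) (hu : 1 ≤ u) (huv : u < v) :
    dv r u v ≤ 1 / 2 := by
  rw [← h.lam_initial (hu.trans huv.le)]
  exact h.lam_anti le_rfl hu huv

theorem nu_anti (h : IsLocallyBoundedSolution φ r m) (hu : 1 ≤ u) (h₁ : u < v₁) (h₂ : v₁ ≤ v₂) :
    du r u v₂ ≤ du r u v₁ := by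
  refine le_of_ae_hasDerivAt_nonpos h₂ (h.nu_ac u v₁ v₂ hu h₁ h₂) ?_
  filter_upwards [h.ae_hasDerivAt_nu_v hu] with v hderiv hv
  have huv := h₁.trans hv.1
  exact ⟨_, hderiv huv, h.potential_nonpos hu huv⟩

theorem r_sub_le (h : IsLocallyBoundedSolution φ r m) (hu : 1 ≤ u) (h₁ : u ≤ v₁) (h₂ : v₁ ≤ v₂) :
    r u v₂ - r u v₁ ≤ (v₂ - v₁) / 2 := by
  have hle := sub_le_sub_of_ae_hasDerivAt_le h₂ (h.r_ac_v_of_le hu h₁ h₂)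
    ((absolutelyContinuousOnInterval_id v₁ v₂).const_mul (1 / 2)) <| by
      filter_upwards [h.ae_hasDerivAt_r_v hu] with v hderiv hv
      have huv := h₁.trans_lt hv.1
      exact ⟨_, _, hderiv huv, (hasDerivAt_id v).const_mul (1 / 2),
        by linarith [h.lam_le_half hu huv]⟩
  linarith

theorem r_le (h : IsLocallyBoundedSolution φ r m) (hu : 1 ≤ u) (huv : u ≤ v) :
    r u v ≤ (v - u) / 2 := by
  simpa [h.r_axis u hu] using h.r_sub_le hu le_rfl huv

theorem mul_sub_le_r_sub (h : IsLocallyBoundedSolution φ r m) (hu : 1 ≤ u) (h₁ : u ≤ v₁)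
    (h₂ : v₁ ≤ v₂) (hl : ∀ v ∈ Ioo v₁ v₂, l ≤ dv r u v) :
    l * (v₂ - v₁) ≤ r u v₂ - r u v₁ := by
  have hle := sub_le_sub_of_ae_hasDerivAt_le h₂
    ((absolutelyContinuousOnInterval_id v₁ v₂).const_mul l) (h.r_ac_v_of_le hu h₁ h₂) <| by
      filter_upwards [h.ae_hasDerivAt_r_v hu] with v hderiv hv
      exact ⟨_, _, (hasDerivAt_id v).const_mul l, hderiv (h₁.trans_lt hv.1), by
        linarith [hl v hv]⟩
  linarith

theorem neg_potential_eq (h : IsLocallyBoundedSolution φ r m) (hu : 1 ≤ u) (huv : u < v) :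
    -potential r m u v =
      2 * m u v / ((1 - massRatio r m u v) * r u v ^ 2) * dv r u v * (-du r u v) := by
  have hr := (h.r_pos u v hu huv).ne'
  have hμ := (h.one_sub_massRatio_pos hu huv).ne'
  have hmass : massRatio r m u v * r u v = 2 * m u v := div_mul_cancel₀ _ hr
  rw [← hmass, potential]
  field_simp

theorem half_le_one_sub_massRatio (h : IsLocallyBoundedSolution φ r m) (hu : 1 ≤ u)
    (huv : u < v) (hmr : 4 * m u v ≤ r u v) : 1 / 2 ≤ 1 - massRatio r m u v := by
  have hμ : massRatio r m u v ≤ 1 / 2 := by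
    rw [massRatio, div_le_iff₀ (h.r_pos u v hu huv)]
    linarith
  linarith

theorem neg_potential_le (h : IsLocallyBoundedSolution φ r m) (hu : 1 ≤ u) (huv : u < v)
    (hM : m u v ≤ M) (hMr : 4 * M ≤ r u v) :
    -potential r m u v ≤ 4 * M / r u v ^ 2 * dv r u v * (-du r u v) := by
  have hr := h.r_pos u v hu huv
  have hlam := h.lam_pos hu huv
  have hm := h.m_nonneg hu huv.le
  have hnu : 0 < -du r u v := neg_pos.2 (h.nu_neg hu huv)
  have hμ := h.half_le_one_sub_massRatio hu huv (by linarith)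
  calc -potential r m u v
      = 2 * m u v / ((1 - massRatio r m u v) * r u v ^ 2) * dv r u v * (-du r u v) :=
        h.neg_potential_eq hu huv
    _ ≤ 2 * M / (1 / 2 * r u v ^ 2) * dv r u v * (-du r u v) := by gcongr; linarith
    _ = 4 * M / r u v ^ 2 * dv r u v * (-du r u v) := by ring

/-- `∂_u log λ ≥ 4 M ν / r²`, which integrates to a multiple of `1 / r`. -/
theorem log_lam_sub_le (h : IsLocallyBoundedSolution φ r m) (hu : 1 ≤ u₁) (h₁ : u₁ ≤ u₂)
    (h₂ : u₂ < v) (hM : m u₁ v ≤ M) (hMr : 4 * M ≤ r u₂ v) :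
    Real.log (dv r u₁ v) - Real.log (dv r u₂ v) ≤ 4 * M / r u₂ v := by
  have hM0 : 0 ≤ M := (h.m_nonneg hu (h₁.trans h₂.le)).trans hM
  have hmem : ∀ u ∈ uIcc u₁ u₂, 1 ≤ u ∧ u < v := by
    rw [uIcc_of_le h₁]
    exact fun u hu' => ⟨hu.trans hu'.1, hu'.2.trans_lt h₂⟩
  have hinv := (absolutelyContinuousOnInterval_inv (h.r_ac_u_of_le hu h₁ h₂.le)
    fun u hu' => h.r_pos u v (hmem u hu').1 (hmem u hu').2).const_mul (4 * M)
  have hlog := (absolutelyContinuousOnInterval_log (h.lam_ac_of_le hu h₁ h₂)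
    fun u hu' => h.lam_pos (hmem u hu').1 (hmem u hu').2).fun_neg
  have hle := sub_le_sub_of_ae_hasDerivAt_le h₁ hlog hinv <| by
    filter_upwards [h.ae_hasDerivAt_lam_u (v := v) (by linarith), h.ae_hasDerivAt_r_u]
      with u hlamd hr hu'
    have hu1 : u ∈ Ioo 1 v := ⟨hu.trans_lt hu'.1, hu'.2.trans h₂⟩
    have hlam := h.lam_pos hu1.1.le hu1.2
    have hrpos := h.r_pos u v hu1.1.le hu1.2
    have hpot := h.neg_potential_le hu1.1.le hu1.2
      ((h.m_anti_u hu hu'.1.le hu1.2.le).trans hM)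
      (hMr.trans (h.r_anti_u hu1.1.le hu'.2.le h₂.le))
    refine ⟨_, _, ((hlamd hu1).log hlam.ne').fun_neg,
      ((hr hu1).fun_inv hrpos.ne').const_mul (4 * M), ?_⟩
    rw [← neg_div, div_le_iff₀ hlam]
    exact hpot.trans_eq (by ring)
  have hnonneg : 0 ≤ 4 * M * (r u₁ v)⁻¹ :=
    mul_nonneg (by linarith) (inv_nonneg.2 (h.r_nonneg hu (h₁.trans h₂.le)))
  rw [div_eq_mul_inv]
  linarith

/-- `∂_v log (-ν) ≤ 4 M λ / r²`, which integrates to a multiple of `1 / r`. -/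
theorem neg_nu_le_exp_one_mul (h : IsLocallyBoundedSolution φ r m) (hu : 1 ≤ u) (h₁ : u < v₁)
    (h₂ : v₁ ≤ v₂) (hM : m u v₂ ≤ M) (hMr : 4 * M ≤ r u v₁) :
    -du r u v₂ ≤ Real.exp 1 * -du r u v₁ := by
  have hM0 : 0 ≤ M := (h.m_nonneg hu (h₁.le.trans h₂)).trans hM
  have hmem : ∀ v ∈ uIcc v₁ v₂, u < v := by
    rw [uIcc_of_le h₂]
    exact fun v hv => h₁.trans_le hv.1
  have hinv := ((absolutelyContinuousOnInterval_inv (h.r_ac_v_of_le hu h₁.le h₂)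
    fun v hv => h.r_pos u v hu (hmem v hv)).const_mul (4 * M)).fun_neg
  have hlog := absolutelyContinuousOnInterval_log (h.nu_ac u v₁ v₂ hu h₁ h₂).fun_neg
    fun v hv => neg_pos.2 (h.nu_neg hu (hmem v hv))
  have hle := sub_le_sub_of_ae_hasDerivAt_le h₂ hlog hinv <| by
    filter_upwards [h.ae_hasDerivAt_nu_v hu, h.ae_hasDerivAt_r_v hu] with v hν hr hv
    have huv : u < v := h₁.trans hv.1
    have hnu := neg_pos.2 (h.nu_neg hu huv)
    have hrpos := h.r_pos u v hu huv
    have hpot := h.neg_potential_le hu huv ((h.m_mono_v hu huv.le hv.2.le).trans hM)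
      (hMr.trans (h.r_mono_v hu h₁.le hv.1.le))
    refine ⟨_, _, (hν huv).fun_neg.log hnu.ne',
      (((hr huv).fun_inv hrpos.ne').const_mul (4 * M)).fun_neg, ?_⟩
    rw [div_le_iff₀ hnu]
    exact hpot.trans_eq (by ring)
  have hone : 4 * M * (r u v₁)⁻¹ ≤ 1 :=
    (div_eq_mul_inv _ _).symm.trans_le (div_le_one_of_le₀ hMr (h.r_nonneg hu h₁.le))
  have hnonneg : 0 ≤ 4 * M * (r u v₂)⁻¹ :=
    mul_nonneg (by linarith) (inv_nonneg.2 (h.r_nonneg hu (h₁.le.trans h₂)))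
  have hν₁ := neg_pos.2 (h.nu_neg hu h₁)
  have hν₂ := neg_pos.2 (h.nu_neg hu (h₁.trans_le h₂))
  rw [← Real.log_le_log_iff hν₂ (by positivity), Real.log_mul (Real.exp_pos 1).ne' hν₁.ne',
    Real.log_exp]
  linarith

end IsLocallyBoundedSolution

namespace IsLocallyBoundedSolution

theorem abs_rphi_sub_le {g : ℝ → ℝ} (h : IsLocallyBoundedSolution φ r m) (hu : 1 ≤ u)
    (h₁ : u ≤ v₁) (h₂ : v₁ ≤ v₂) (hg : AbsolutelyContinuousOnInterval g v₁ v₂)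
    (hdom : ∀ᵐ v, v ∈ Ioo v₁ v₂ → ∃ g', HasDerivAt g g' v ∧ |dv (r * φ) u v| ≤ g') :
    |r u v₂ * φ u v₂ - r u v₁ * φ u v₁| ≤ g v₂ - g v₁ := by
  refine abs_sub_le_sub_of_ae_hasDerivAt (f := fun v => (r * φ) u v) h₂
    (h.rphi_ac_v_of_le hu h₁ h₂) hg ?_
  filter_upwards [hdom, h.ae_hasDerivAt_rphi_v hu] with v hg' hrphi hv
  obtain ⟨g', hgderiv, hle⟩ := hg' hv
  exact ⟨_, g', hrphi (h₁.trans_lt hv.1), hgderiv, hle⟩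

theorem abs_phi_le (h : IsLocallyBoundedSolution φ r m) (hu : 1 ≤ u) (huv : u < v)
    (hH : ∀ s ∈ Ioo u v, |dv (r * φ) u s| ≤ H * dv r u s) : |φ u v| ≤ H := by
  have hr := h.r_pos u v hu huv
  have hle := h.abs_rphi_sub_le hu le_rfl huv.le ((h.r_ac_v u v hu huv.le).const_mul H) <| by
    filter_upwards [h.ae_hasDerivAt_r_v hu] with s hderiv hs
    exact ⟨_, (hderiv hs.1).const_mul H, hH s hs⟩
  rw [h.r_axis u hu, zero_mul, sub_zero, mul_zero, sub_zero, abs_mul, abs_of_pos hr,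
    mul_comm] at hle
  exact le_of_mul_le_mul_right hle hr

theorem ae_r_mul_dv_phi (h : IsLocallyBoundedSolution φ r m) (hu : 1 ≤ u) :
    ∀ᵐ v, v ∈ Ioi u → r u v * dv φ u v = dv (r * φ) u v - dv r u v * φ u v := by
  filter_upwards [h.ae_hasDerivAt_r_v hu, h.ae_hasDerivAt_phi_v hu, h.ae_hasDerivAt_rphi_v hu]
    with v hr hφ hrφ hv
  have hproduct := (hrφ hv).unique ((hr hv).mul (hφ hv))
  linarith

theorem ae_two_mul_dv_m (h : IsLocallyBoundedSolution φ r m) (hu : 1 ≤ u) :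
    ∀ᵐ v, v ∈ Ioi u → 2 * dv m u v =
      (1 - massRatio r m u v) * (dv r u v * (dv (r * φ) u v / dv r u v - φ u v) ^ 2) := by
  filter_upwards [h.ae_r_mul_dv_phi hu, h.eq_dv_m u hu] with v hproduct heq hv
  have hlam := (h.lam_pos hu hv).ne'
  apply mul_left_cancel₀ hlam
  calc dv r u v * (2 * dv m u v)
      = (1 - massRatio r m u v) * (r u v * dv φ u v) ^ 2 := by
        rw [mul_pow, ← mul_assoc (1 - massRatio r m u v), ← heq hv]; ring
    _ = dv r u v * ((1 - massRatio r m u v) *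
          (dv r u v * (dv (r * φ) u v / dv r u v - φ u v) ^ 2)) := by
        rw [hproduct hv]; field_simp

theorem ae_two_mul_dv_m_le (h : IsLocallyBoundedSolution φ r m) (hu : 1 ≤ u)
    (hH : ∀ s ∈ Ioo u v, |dv (r * φ) u s| ≤ H * dv r u s) :
    ∀ᵐ s, s ∈ Ioo u v →
      2 * dv m u s ≤ (1 - massRatio r m u s) * (dv r u s * (4 * H ^ 2)) := by
  filter_upwards [h.ae_two_mul_dv_m hu] with s heq hs
  have hlam := h.lam_pos hu hs.1
  have hμ := h.one_sub_massRatio_pos hu hs.1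
  have hφ : |φ u s| ≤ H := h.abs_phi_le hu hs.1 fun t ht => hH t ⟨ht.1, ht.2.trans hs.2⟩
  have hratio : |dv (r * φ) u s / dv r u s| ≤ H := by
    rw [abs_div, abs_of_pos hlam, div_le_iff₀ hlam]
    exact hH s hs
  have hsq : (dv (r * φ) u s / dv r u s - φ u s) ^ 2 ≤ (2 * H) ^ 2 :=
    sq_le_sq.2 ((abs_sub _ _).trans (by linarith [le_abs_self (2 * H)]))
  rw [heq hs.1]
  gcongr
  exact hsq.trans_eq (by ring)

/-- Where `μ > κ := 4 H² / (1 + 4 H²)` the mass equation gives `∂_v (2 m) ≤ κ λ`, so that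
`2 m - κ r`, which vanishes on the axis, cannot become positive. -/
theorem inv_le_one_sub_massRatio (h : IsLocallyBoundedSolution φ r m) (hu : 1 ≤ u) (huv : u < v)
    (hH : ∀ s ∈ Ioo u v, |dv (r * φ) u s| ≤ H * dv r u s) :
    (1 + 4 * H ^ 2)⁻¹ ≤ 1 - massRatio r m u v := by
  set κ := 4 * H ^ 2 / (1 + 4 * H ^ 2) with hκ
  have hinv : (1 + 4 * H ^ 2)⁻¹ = 1 - κ := by rw [hκ]; field_simp; ring
  have hfix : (1 - κ) * (4 * H ^ 2) = κ := by rw [hκ]; field_simp; ring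
  have hle := nonpos_of_ae_hasDerivAt_nonpos_of_pos (f := fun s => 2 * m u s - κ * r u s) huv.le
    (((h.m_ac_v u v hu huv.le).const_mul 2).fun_sub ((h.r_ac_v u v hu huv.le).const_mul κ))
    (by simp [h.r_axis u hu, h.m_axis u hu]) <| by
      filter_upwards [h.ae_hasDerivAt_r_v hu, h.ae_hasDerivAt_m_v hu, h.ae_two_mul_dv_m_le hu hH]
        with s hr hm hdm hs hpos
      refine ⟨_, ((hm hs.1).const_mul 2).fun_sub ((hr hs.1).const_mul κ), ?_⟩
      have hlam := h.lam_pos hu hs.1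
      have hμ : κ < massRatio r m u s := by
        rw [massRatio, lt_div_iff₀ (h.r_pos u s hu hs.1)]
        linarith
      calc 2 * dv m u s - κ * dv r u s
          ≤ (1 - massRatio r m u s) * (dv r u s * (4 * H ^ 2)) - κ * dv r u s := by
            linarith [hdm hs]
        _ ≤ (1 - κ) * (dv r u s * (4 * H ^ 2)) - κ * dv r u s := by gcongr
        _ = ((1 - κ) * (4 * H ^ 2) - κ) * dv r u s := by ring
        _ = 0 := by rw [hfix]; ring
  have hμ : massRatio r m u v ≤ κ := by
    rw [massRatio, div_le_iff₀ (h.r_pos u v hu huv)]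
    linarith
  linarith

theorem exists_one_sub_massRatio_ge (h : IsLocallyBoundedSolution φ r m) (hu : 1 ≤ u) (V : ℝ) :
    ∃ c : ℝ, 0 < c ∧ ∀ v, u < v → v ≤ V → c ≤ 1 - massRatio r m u v := by
  obtain ⟨l, hl, hlam⟩ := h.lam_bdd_below V
  obtain ⟨F, hF⟩ := h.dv_rphi_bdd u V hu
  refine ⟨(1 + 4 * (F / l) ^ 2)⁻¹, by positivity, fun v huv hv =>
    h.inv_le_one_sub_massRatio hu huv fun s hs => ?_⟩
  have hsV : s ≤ V := hs.2.le.trans hv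
  have hF0 : 0 ≤ F := (abs_nonneg _).trans (hF s hs.1 hsV)
  calc |dv (r * φ) u s| ≤ F / l * l := by rw [div_mul_cancel₀ _ hl.ne']; exact hF s hs.1 hsV
    _ ≤ F / l * dv r u s := by gcongr; exact hlam u s hu hs.1 hsV

/-! ### Outgoing null curves reach infinity -/

theorem lintegral_omegaSq_Ioc_lt_top (h : IsLocallyBoundedSolution φ r m) (hu : 1 ≤ u) (V : ℝ) :
    ∫⁻ v in Ioc u V, ENNReal.ofReal (omegaSq r m u v) < ∞ := by
  obtain ⟨c, hc, hμ⟩ := h.exists_one_sub_massRatio_ge hu V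
  obtain ⟨N, hN⟩ := h.neg_nu_bdd V
  calc ∫⁻ v in Ioc u V, ENNReal.ofReal (omegaSq r m u v)
      ≤ ∫⁻ _ in Ioc u V, ENNReal.ofReal (4 * N * (1 / 2) / c) := by
        refine setLIntegral_mono' measurableSet_Ioc fun v hv => ENNReal.ofReal_le_ofReal ?_
        have hlam := h.lam_pos hu hv.1
        have hnu := h.nu_neg hu hv.1
        have hle : -4 * du r u v ≤ 4 * N := by linarith [hN u v hu hv.1 hv.2]
        have hN0 : 0 ≤ 4 * N := by linarith
        rw [omegaSq]
        gcongr
        exacts [h.lam_le_half hu hv.1, hμ v hv.1 hv.2]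
    _ < ∞ := by
        rw [lintegral_const]
        exact ENNReal.mul_lt_top ENNReal.ofReal_lt_top (by simp)

theorem lintegral_lam_Ioi_le (h : IsLocallyBoundedSolution φ r m) (hu : 1 ≤ u) (huv : u ≤ v)
    (hρ : ∀ w, v ≤ w → r u w ≤ ρ) :
    ∫⁻ w in Ioi v, ENNReal.ofReal (dv r u w) ≤ ENNReal.ofReal ρ := by
  refine lintegral_Ioi_le_of_forall_Ioc fun w hw => ?_
  refine (lintegral_derivWithin_Ioi_eq hw (h.r_ac_v_of_le hu huv hw) fun x hx =>
    (h.lam_pos hu (huv.trans_lt hx.1)).le).trans_le (ENNReal.ofReal_le_ofReal ?_)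
  linarith [hρ w hw, h.r_nonneg hu huv]

theorem omegaSq_le (h : IsLocallyBoundedSolution φ r m) (hu : 1 ≤ u) (h₁ : u < v₁)
    (h₂ : v₁ ≤ v₂) (hM : m u v₂ ≤ M) (hMr : 4 * M ≤ r u v₁) :
    omegaSq r m u v₂ ≤ 8 * (Real.exp 1 * -du r u v₁) * dv r u v₂ := by
  have huv := h₁.trans_le h₂
  have hlam := h.lam_pos hu huv
  have hnu := h.nu_neg hu h₁
  have hμ := h.half_le_one_sub_massRatio hu huv
    (by linarith [h.r_mono_v hu h₁.le h₂])
  rw [omegaSq, div_le_iff₀ (by linarith)]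
  calc -4 * du r u v₂ * dv r u v₂ = 4 * (-du r u v₂) * dv r u v₂ := by ring
    _ ≤ 4 * (Real.exp 1 * -du r u v₁) * dv r u v₂ := by
        gcongr
        exact h.neg_nu_le_exp_one_mul hu h₁ h₂ hM hMr
    _ = 8 * (Real.exp 1 * -du r u v₁) * dv r u v₂ * (1 / 2) := by ring
    _ ≤ 8 * (Real.exp 1 * -du r u v₁) * dv r u v₂ * (1 - massRatio r m u v₂) := by
        have hcoeff : 0 < Real.exp 1 * -du r u v₁ := mul_pos (Real.exp_pos 1) (neg_pos.2 hnu)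
        gcongr

theorem lintegral_omegaSq_Ioi_lt_top (h : IsLocallyBoundedSolution φ r m) (hu : 1 ≤ u)
    (huv : u < v) (hM : ∀ w, v ≤ w → m u w ≤ M) (hMr : 4 * M ≤ r u v)
    (hρ : ∀ w, v ≤ w → r u w ≤ ρ) : ∫⁻ w in Ioi v, ENNReal.ofReal (omegaSq r m u w) < ∞ := by
  have hN : 0 ≤ 8 * (Real.exp 1 * -du r u v) := by
    have hnu := h.nu_neg hu huv
    have := Real.exp_pos 1
    nlinarith
  calc ∫⁻ w in Ioi v, ENNReal.ofReal (omegaSq r m u w)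
      ≤ ∫⁻ w in Ioi v,
          ENNReal.ofReal (8 * (Real.exp 1 * -du r u v)) * ENNReal.ofReal (dv r u w) := by
        refine setLIntegral_mono' measurableSet_Ioi fun w hw => ?_
        rw [← ENNReal.ofReal_mul hN]
        exact ENNReal.ofReal_le_ofReal
          (h.omegaSq_le hu huv (le_of_lt hw) (hM w (le_of_lt hw)) hMr)
    _ = ENNReal.ofReal (8 * (Real.exp 1 * -du r u v)) *
          ∫⁻ w in Ioi v, ENNReal.ofReal (dv r u w) :=
        lintegral_const_mul' _ _ ENNReal.ofReal_ne_top
    _ < ∞ := ENNReal.mul_lt_top ENNReal.ofReal_lt_top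
        ((h.lintegral_lam_Ioi_le hu huv.le hρ).trans_lt ENNReal.ofReal_lt_top)

theorem exists_r_ge_of_log_lam (h : IsLocallyBoundedSolution φ r m) (hu : 1 ≤ u) (hδ : 0 ≤ δ)
    (hTV : eVariationOn (fun v => Real.log (dv r u v)) {v | u ≤ v ∧ r u v ≤ R} ≤
      ENNReal.ofReal δ) : ∃ v, u < v ∧ R ≤ r u v := by
  by_contra! hcon
  have hbase : u < u + 1 := lt_add_one u
  have hbase_pos := h.lam_pos hu hbase
  set l := dv r u (u + 1) * Real.exp (-δ) with hl
  have hl0 : 0 < l := mul_pos hbase_pos (Real.exp_pos _)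
  have hlam : ∀ v, u < v → l ≤ dv r u v := by
    intro v hv
    have hlog := (abs_le.1 (abs_sub_le_of_eVariationOn_le hδ hTV
      (x := v) ⟨hv.le, (hcon v hv).le⟩ ⟨hbase.le, (hcon _ hbase).le⟩)).1
    rw [← Real.log_le_log_iff hl0 (h.lam_pos hu hv), hl,
      Real.log_mul hbase_pos.ne' (Real.exp_pos _).ne', Real.log_exp]
    linarith
  have hR : 0 < R := (h.r_pos u _ hu hbase).trans (hcon _ hbase)
  have hfar : u < u + R / l := lt_add_of_pos_right u (div_pos hR hl0)
  have hgrow := h.mul_sub_le_r_sub hu le_rfl hfar.le fun v hv => hlam v hv.1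
  rw [h.r_axis u hu, add_sub_cancel_left, mul_div_cancel₀ _ hl0.ne'] at hgrow
  linarith [hcon _ hfar]

end IsLocallyBoundedSolution

namespace IsLocallyBoundedScattering

theorem exists_mass_bound (h : IsLocallyBoundedScattering φ r m) :
    ∃ M : ℝ → ℝ, (∀ u v, 1 ≤ u → u ≤ v → m u v ≤ M u) ∧ Tendsto M atTop (𝓝 0) := by
  obtain ⟨M, hM, hM0⟩ := h.final_bondi_mass
  refine ⟨M, fun u v hu huv => ge_of_tendsto (hM u hu) ?_, hM0⟩
  filter_upwards [eventually_ge_atTop v] with w hw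
  exact h.m_mono_v hu huv hw

/-- If `r` were bounded on `C_u`, then `Ω²` would be integrable there, contradicting
completeness. -/
theorem exists_r_ge_of_far (h : IsLocallyBoundedScattering φ r m) (hu : 1 ≤ u) (huv : u < v)
    (hM : ∀ w, v ≤ w → m u w ≤ M) (hMr : 4 * M ≤ r u v) (ρ : ℝ) :
    ∃ w, v ≤ w ∧ ρ ≤ r u w := by
  by_contra! hcon
  have hfar := h.lintegral_omegaSq_Ioi_lt_top hu huv hM hMr fun w hw => (hcon w hw).le
  have htotal := h.outgoing_complete u hu
  rw [← Ioc_union_Ioi_eq_Ioi huv.le] at htotal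
  exact ((lintegral_union_le _ (Ioc u v) (Ioi v)).trans_lt
    (ENNReal.add_lt_top.2 ⟨h.lintegral_omegaSq_Ioc_lt_top hu v, hfar⟩)).ne htotal

theorem exists_r_ge (h : IsLocallyBoundedScattering φ r m) (hu : 1 ≤ u) (ρ : ℝ) :
    ∃ v, u < v ∧ ρ ≤ r u v := by
  obtain ⟨R, hR, -, hTV⟩ := h.scattering
  obtain ⟨M, hM, hM0⟩ := h.exists_mass_bound
  have hsmall := hM0.eventually (ge_mem_nhds (show 0 < R / 4 by positivity))
  obtain ⟨w, hTVw, hMw, huw⟩ := ((ENNReal.tendsto_nhds_zero.1 hTV (ENNReal.ofReal 1)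
    (by simp)).and (hsmall.and (eventually_ge_atTop u))).exists
  have hw : 1 ≤ w := hu.trans huw
  obtain ⟨v₁, hv₁, hRv₁⟩ := h.exists_r_ge_of_log_lam hw zero_le_one hTVw
  obtain ⟨v, hv, hρ⟩ :=
    h.exists_r_ge_of_far hw hv₁ (fun v hv => hM w v hw (hv₁.le.trans hv)) (by linarith) ρ
  exact ⟨v, huw.trans_lt (hv₁.trans_le hv), hρ.trans (h.r_anti_u hu huw (hv₁.le.trans hv))⟩

theorem exists_r_eq (h : IsLocallyBoundedScattering φ r m) (hu : 1 ≤ u) (huv : u ≤ v)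
    (hR : r u v ≤ R) : ∃ w, v ≤ w ∧ r u w = R := by
  obtain ⟨v₁, hv₁, hRv₁⟩ := h.exists_r_ge hu R
  have hcont := (h.r_ac_v_of_le hu huv (le_max_left v v₁)).continuousOn
  rw [uIcc_of_le (le_max_left v v₁)] at hcont
  obtain ⟨w, hw, hw'⟩ := intermediate_value_Icc (le_max_left v v₁) hcont
    ⟨hR, hRv₁.trans (h.r_mono_v hu hv₁.le (le_max_right _ _))⟩
  exact ⟨w, hw.1, hw'⟩

/-! ### Uniform bounds for `λ` -/

theorem exists_forall_r_ge (h : IsLocallyBoundedScattering φ r m) (hU : 1 ≤ U) (ρ : ℝ) :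
    ∃ V, U < V ∧ ∀ u v, 1 ≤ u → u ≤ U → V ≤ v → ρ ≤ r u v := by
  obtain ⟨V, hV, hρ⟩ := h.exists_r_ge hU ρ
  exact ⟨V, hV, fun u v hu huU hVv => (hρ.trans (h.r_mono_v hU hV.le hVv)).trans
    (h.r_anti_u hu huU (hV.le.trans hVv))⟩

theorem exists_forall_log_lam_ge_of_le (h : IsLocallyBoundedScattering φ r m) (hU : 1 ≤ U)
    (hε : 0 < ε) :
    ∃ V, U < V ∧ ∀ u v, 1 ≤ u → u ≤ U → V ≤ v →
      Real.log (1 / 2) - ε ≤ Real.log (dv r u v) := by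
  obtain ⟨M, hM, -⟩ := h.exists_mass_bound
  obtain ⟨V, hV, hr⟩ := h.exists_forall_r_ge hU (max (4 * M 1) (4 * M 1 / ε))
  refine ⟨V, hV, fun u v hu huU hVv => ?_⟩
  have huv : u < v := huU.trans_lt (hV.trans_le hVv)
  obtain ⟨hMr, hMrε⟩ := max_le_iff.1 (hr u v hu huU hVv)
  have hlog := h.log_lam_sub_le le_rfl hu huv (hM 1 v le_rfl (hu.trans huv.le)) hMr
  rw [h.lam_initial (hu.trans huv.le)] at hlog
  have hsmall : 4 * M 1 / r u v ≤ ε := (div_le_comm₀ (h.r_pos u v hu huv) hε).2 hMrε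
  linarith

/-- Integrate `∂_u log λ` from `C_U` to `C_u`: on `C_U` the function `λ` is close to `1 / 2` for
large `v`, and in `r ≥ R` the increment is controlled by the Bondi mass `M U / R`. -/
theorem exists_forall_log_lam_ge_of_r_ge (h : IsLocallyBoundedScattering φ r m) (hR : 0 < R)
    (hε : 0 < ε) :
    ∃ U, 1 ≤ U ∧ ∀ u v, U ≤ u → u < v → R ≤ r u v →
      Real.log (1 / 2) - ε ≤ Real.log (dv r u v) := by
  obtain ⟨M, hM, hM0⟩ := h.exists_mass_bound
  have hε2 : 0 < ε / 2 := by positivity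
  obtain ⟨U, hMU, hU⟩ :=
    ((hM0.eventually (ge_mem_nhds (show 0 < R / 4 * min 1 (ε / 2) by positivity))).and
      (eventually_ge_atTop 1)).exists
  obtain ⟨V, hV, hlog⟩ := h.exists_forall_log_lam_ge_of_le hU hε2
  refine ⟨V, hU.trans hV.le, fun u v hu huv hRr => ?_⟩
  have hUu : U ≤ u := hV.le.trans hu
  have hMR : 4 * M U ≤ R := by nlinarith [min_le_left 1 (ε / 2)]
  have hMRε : 4 * M U ≤ ε / 2 * R := by nlinarith [min_le_right 1 (ε / 2)]
  have hstart := hlog U v hU le_rfl (hu.trans huv.le)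
  have hincr := h.log_lam_sub_le hU hUu huv (hM U v hU (hUu.trans huv.le)) (hMR.trans hRr)
  have hsmall : 4 * M U / r u v ≤ ε / 2 := by
    rw [div_le_iff₀ (hR.trans_le hRr)]
    exact hMRε.trans (by gcongr)
  linarith

theorem exists_forall_log_lam_ge (h : IsLocallyBoundedScattering φ r m) (hε : 0 < ε) :
    ∃ U, 1 ≤ U ∧ ∀ u v, U ≤ u → u < v → Real.log (1 / 2) - ε ≤ Real.log (dv r u v) := by
  obtain ⟨R, hR, -, hTV⟩ := h.scattering
  have hε2 : 0 < ε / 2 := by positivity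
  obtain ⟨U₁, hvar⟩ := eventually_atTop.1
    (ENNReal.tendsto_nhds_zero.1 hTV (ENNReal.ofReal (ε / 2)) (by simpa))
  obtain ⟨U₂, hU₂, hfar⟩ := h.exists_forall_log_lam_ge_of_r_ge hR hε2
  refine ⟨max U₁ U₂, hU₂.trans (le_max_right _ _), fun u v hu huv => ?_⟩
  obtain ⟨hUu₁, hUu₂⟩ := max_le_iff.1 hu
  rcases le_or_gt (r u v) R with hle | hgt
  · obtain ⟨w, hw, hwR⟩ := h.exists_r_eq (hU₂.trans hUu₂) huv.le hle
    have huw : u < w := huv.trans_le hw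
    have hexit := hfar u w hUu₂ huw hwR.ge
    have hincr := (abs_le.1 (abs_sub_le_of_eVariationOn_le hε2.le (hvar u hUu₁)
      (x := v) ⟨huv.le, hle⟩ ⟨huw.le, hwR.le⟩)).1
    linarith
  · linarith [hfar u v hUu₂ huv hgt.le]

theorem exists_forall_lam_ge (h : IsLocallyBoundedScattering φ r m) (hl0 : 0 < l)
    (hl : l < 1 / 2) : ∃ U, 1 ≤ U ∧ ∀ u v, U ≤ u → u < v → l ≤ dv r u v := by
  obtain ⟨U, hU, hlam⟩ := h.exists_forall_log_lam_ge (sub_pos.2 (Real.log_lt_log hl0 hl))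
  refine ⟨U, hU, fun u v hu huv => ?_⟩
  have hlog := hlam u v hu huv
  rw [sub_sub_cancel] at hlog
  exact (Real.log_le_log_iff hl0 (h.lam_pos (hU.trans hu) huv)).1 hlog

theorem exists_lam_ge (h : IsLocallyBoundedScattering φ r m) :
    ∃ l : ℝ, 0 < l ∧ ∀ u v, 1 ≤ u → u < v → l ≤ dv r u v := by
  obtain ⟨U, hU, hlate⟩ := h.exists_forall_lam_ge (l := 1 / 4) (by norm_num) (by norm_num)
  obtain ⟨V, -, hfar⟩ := h.exists_forall_log_lam_ge_of_le hU one_pos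
  obtain ⟨c, hc, hnear⟩ := h.lam_bdd_below V
  refine ⟨min (1 / 4) (min (1 / 2 * Real.exp (-1)) c), by positivity, fun u v hu huv => ?_⟩
  rcases le_or_gt U u with hUu | hUu
  · exact (min_le_left _ _).trans (hlate u v hUu huv)
  refine (min_le_right _ _).trans ?_
  rcases le_or_gt V v with hVv | hVv
  · refine (min_le_left _ _).trans ?_
    rw [← Real.log_le_log_iff (by positivity) (h.lam_pos hu huv),
      Real.log_mul (by norm_num) (Real.exp_pos _).ne', Real.log_exp]
    linarith [hfar u v hu hUu.le hVv]
  · exact (min_le_right _ _).trans (hnear u v hu huv hVv.le)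

end IsLocallyBoundedScattering

/-! ### Propagating bounds for `∂_v (r φ)` -/

namespace IsLocallyBoundedSolution

theorem abs_dv_rphi_sub_le {g : ℝ → ℝ} (h : IsLocallyBoundedSolution φ r m) (hu : 1 ≤ u₁)
    (h₁ : u₁ ≤ u₂) (h₂ : u₂ < v) (hg : AbsolutelyContinuousOnInterval g u₁ u₂)
    (hdom : ∀ᵐ u, u ∈ Ioo u₁ u₂ →
      ∃ g', HasDerivAt g g' u ∧ -potential r m u v * |φ u v| ≤ g') :
    |dv (r * φ) u₂ v - dv (r * φ) u₁ v| ≤ g u₂ - g u₁ := by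
  refine abs_sub_le_sub_of_ae_hasDerivAt (f := fun u => dv (r * φ) u v) h₁
    (h.dv_rphi_ac_of_le hu h₁ h₂) hg ?_
  filter_upwards [hdom, h.ae_hasDerivAt_dv_rphi_u (v := v) (by linarith)] with u hg' hwave hmem
  have hu' : u ∈ Ioo 1 v := ⟨hu.trans_lt hmem.1, hmem.2.trans h₂⟩
  obtain ⟨g', hgderiv, hle⟩ := hg' hmem
  refine ⟨_, g', hwave hu', hgderiv, ?_⟩
  rwa [abs_mul, abs_of_nonpos (h.potential_nonpos hu'.1.le hu'.2)]

/-- The potential is `∂_u λ`, so its integral in `u` is the decrement of `λ`. -/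
theorem abs_dv_rphi_sub_le_lam (h : IsLocallyBoundedSolution φ r m) (hu : 1 ≤ u₁) (h₁ : u₁ ≤ u₂)
    (h₂ : u₂ < v) (hX : ∀ u ∈ Ioo u₁ u₂, |φ u v| ≤ X) :
    |dv (r * φ) u₂ v - dv (r * φ) u₁ v| ≤ X * (dv r u₁ v - dv r u₂ v) := by
  have hle := h.abs_dv_rphi_sub_le hu h₁ h₂ ((h.lam_ac_of_le hu h₁ h₂).const_mul (-X)) <| by
    filter_upwards [h.ae_hasDerivAt_lam_u (v := v) (by linarith)] with u hderiv hmem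
    have hu' : u ∈ Ioo 1 v := ⟨hu.trans_lt hmem.1, hmem.2.trans h₂⟩
    refine ⟨_, (hderiv hu').const_mul (-X), ?_⟩
    nlinarith [h.potential_nonpos hu'.1.le hu'.2, hX u hmem]
  linarith

theorem abs_rphi_sub_le_of_rpow (h : IsLocallyBoundedSolution φ r m) (hu : 1 ≤ u) (h₁ : u ≤ v₁)
    (h₂ : v₁ ≤ v₂) (hp : 1 < p) (hC : 0 ≤ C)
    (hf : ∀ s ∈ Ioo v₁ v₂, |dv (r * φ) u s| ≤ C * s ^ (-p)) :
    |r u v₂ * φ u v₂ - r u v₁ * φ u v₁| ≤ C * (v₁ ^ (1 - p) / (p - 1)) := by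
  have hv₁ : 0 < v₁ := by linarith
  have hac : AbsolutelyContinuousOnInterval (fun s : ℝ => -(s ^ (1 - p) / (p - 1))) v₁ v₂ := by
    simpa only [div_eq_inv_mul] using
      ((absolutelyContinuousOnInterval_rpow (1 - p) hv₁ h₂).const_mul (p - 1)⁻¹).fun_neg
  have hle := h.abs_rphi_sub_le hu h₁ h₂ (hac.const_mul C) <| Eventually.of_forall fun s hs =>
    ⟨_, (hasDerivAt_neg_rpow_one_sub_div hp (hv₁.trans hs.1)).const_mul C, hf s hs⟩
  have hend : 0 ≤ C * (v₂ ^ (1 - p) / (p - 1)) := by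
    have : 0 < v₂ := hv₁.trans_le h₂
    have : 0 < p - 1 := by linarith
    positivity
  linarith

theorem neg_potential_mul_abs_phi_le (h : IsLocallyBoundedSolution φ r m) (hu : 1 ≤ u)
    (huv : 2 * u ≤ v) (hl : 0 < l) (hr : l * (v - u) ≤ r u v) (hM : m u v ≤ M)
    (hMv : 8 * M ≤ l * v) (hK : -du r u v ≤ K) :
    -potential r m u v * |φ u v| ≤
      16 * M * K / l ^ 3 * v ^ (-3 : ℝ) * |r u v * φ u v| := by
  have huv' : u < v := by linarith
  have hv : 0 < v := by linarith
  have hrv : l * v / 2 ≤ r u v := by nlinarith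
  have hr0 := h.r_pos u v hu huv'
  have hM0 := (h.m_nonneg hu huv'.le).trans hM
  have hlam := h.lam_pos hu huv'
  have hnu := h.nu_neg hu huv'
  have hK0 : 0 ≤ K := by linarith
  calc -potential r m u v * |φ u v|
      ≤ 4 * M / r u v ^ 2 * dv r u v * (-du r u v) * |φ u v| := by
        gcongr
        exact h.neg_potential_le hu huv' hM (by linarith)
    _ ≤ 4 * M / r u v ^ 2 * (1 / 2) * K * |φ u v| := by
        gcongr
        · linarith
        · exact h.lam_le_half hu huv'
    _ = 2 * M * K / r u v ^ 3 * |r u v * φ u v| := by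
        rw [abs_mul, abs_of_pos hr0]
        field_simp
        ring
    _ ≤ 2 * M * K / (l * v / 2) ^ 3 * |r u v * φ u v| := by gcongr
    _ = 16 * M * K / l ^ 3 * v ^ (-3 : ℝ) * |r u v * φ u v| := by
        rw [Real.rpow_neg hv.le, show (3 : ℝ) = ((3 : ℕ) : ℝ) by norm_num, Real.rpow_natCast]
        field_simp
        ring

end IsLocallyBoundedSolution

/-! ### Decay in `v` for bounded `u` -/

theorem exists_abs_dv_rphi_initial_le {ω' : ℝ} (h : IsSolution φ r m) (hω : 0 ≤ ω)
    (hωω' : ω ≤ ω') (hflat : IsAsymptoticallyFlatBV φ r ω') :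
    ∃ I : ℝ, ∀ v, 1 ≤ v → |dv (r * φ) 1 v| ≤ I * v ^ (-ω) := by
  obtain ⟨-, I, -, hdecay⟩ := hflat
  refine ⟨I * 2 ^ ω, fun v hv => ?_⟩
  have hv0 : 0 < v := by linarith
  have hr : 1 + r 1 v = (v + 1) / 2 := by linarith [h.r_initial v hv]
  have hweight : (v / 2) ^ ω ≤ (1 + r 1 v) ^ ω' :=
    calc (v / 2) ^ ω ≤ (1 + r 1 v) ^ ω := by rw [hr]; gcongr; linarith
      _ ≤ (1 + r 1 v) ^ ω' := Real.rpow_le_rpow_of_exponent_le (by linarith) hωω'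
  have hle : (v / 2) ^ ω * |dv (r * φ) 1 v| ≤ I := le_trans (by gcongr) (hdecay v hv)
  rw [Real.div_rpow hv0.le zero_le_two, div_mul_eq_mul_div, div_le_iff₀ (by positivity)] at hle
  rw [Real.rpow_neg hv0.le, ← div_eq_mul_inv, le_div_iff₀ (by positivity)]
  linarith

namespace IsLocallyBoundedSolution

theorem exists_abs_rphi_le (h : IsLocallyBoundedSolution φ r m) (V : ℝ) :
    ∃ D : ℝ, 0 ≤ D ∧ ∀ u v, 1 ≤ u → u ≤ v → v ≤ V → |r u v * φ u v| ≤ D := by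
  obtain ⟨C, hC⟩ := h.phi_bdd V
  refine ⟨|V| * |C|, by positivity, fun u v hu huv hv => ?_⟩
  rcases huv.eq_or_lt with rfl | huv
  · rw [h.r_axis u hu, zero_mul, abs_zero]
    positivity
  have hr : r u v ≤ |V| := by linarith [h.r_le hu huv.le, le_abs_self V]
  rw [abs_mul, abs_of_pos (h.r_pos u v hu huv)]
  exact mul_le_mul hr ((hC u v hu huv hv).trans (le_abs_self C)) (abs_nonneg _) (abs_nonneg _)

theorem exists_abs_dv_rphi_le_initial_add (h : IsLocallyBoundedSolution φ r m) (V : ℝ) :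
    ∃ D : ℝ, 0 ≤ D ∧ ∀ u v, 1 ≤ u → u < v → v ≤ V →
      |dv (r * φ) u v| ≤ |dv (r * φ) 1 v| + D := by
  obtain ⟨C, hC⟩ := h.phi_bdd V
  refine ⟨|C|, abs_nonneg C, fun u v hu huv hv => ?_⟩
  have hincr := h.abs_dv_rphi_sub_le_lam le_rfl hu huv fun u' hu' =>
    (hC u' v hu'.1.le (hu'.2.trans huv) hv).trans (le_abs_self C)
  have hlam : |C| * (dv r 1 v - dv r u v) ≤ |C| * 1 := by
    gcongr
    linarith [h.lam_initial (v := v) (by linarith), h.lam_pos hu huv]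
  linarith [abs_sub_abs_le_abs_sub (dv (r * φ) u v) (dv (r * φ) 1 v)]

theorem abs_dv_rphi_le_of_far (h : IsLocallyBoundedSolution φ r m) (hv : 0 < v) (hu : 1 ≤ u)
    (huv : u < v) (hC : 0 ≤ C) (hX : 0 ≤ X)
    (hpot : ∀ u' ∈ Ioo 1 u,
      -potential r m u' v * |φ u' v| ≤ C * v ^ (-3 : ℝ) * |r u' v * φ u' v|)
    (hrphi : ∀ u' ∈ Ioo 1 u, |r u' v * φ u' v| ≤ X) :
    |dv (r * φ) u v| ≤ |dv (r * φ) 1 v| + C * u * X * v ^ (-3 : ℝ) := by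
  have hincr := h.abs_dv_rphi_sub_le le_rfl hu huv
    ((absolutelyContinuousOnInterval_id 1 u).const_mul (C * v ^ (-3 : ℝ) * X)) <|
    Eventually.of_forall fun u' hu' => by
      refine ⟨_, (hasDerivAt_id' u').const_mul _, (hpot u' hu').trans ?_⟩
      rw [mul_one]
      gcongr
      exact hrphi u' hu'
  have hnonneg : 0 ≤ C * v ^ (-3 : ℝ) * X := by positivity
  linarith [abs_sub_abs_le_abs_sub (dv (r * φ) u v) (dv (r * φ) 1 v)]

theorem abs_dv_rphi_le_of_far_rpow (h : IsLocallyBoundedSolution φ r m) (hω : ω ≤ 3) (hC : 0 ≤ C)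
    (hX : 0 ≤ X) (hu : 1 ≤ u) (huU : u ≤ U) (huv : u < v)
    (hinit : |dv (r * φ) 1 v| ≤ I * v ^ (-ω))
    (hpot : ∀ u' ∈ Ioo 1 u,
      -potential r m u' v * |φ u' v| ≤ C * v ^ (-3 : ℝ) * |r u' v * φ u' v|)
    (hrphi : ∀ u' ∈ Ioo 1 u, |r u' v * φ u' v| ≤ X) :
    |dv (r * φ) u v| ≤ (I + C * U * X) * v ^ (-ω) := by
  have hv : 1 ≤ v := hu.trans huv.le
  have hnonneg : 0 ≤ C * U * X := by
    have : 0 ≤ U := by linarith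
    positivity
  calc |dv (r * φ) u v| ≤ |dv (r * φ) 1 v| + C * u * X * v ^ (-3 : ℝ) :=
        h.abs_dv_rphi_le_of_far (by linarith) hu huv hC hX hpot hrphi
    _ ≤ I * v ^ (-ω) + C * U * X * v ^ (-ω) := by
        gcongr
    _ = (I + C * U * X) * v ^ (-ω) := by ring

theorem abs_rphi_le_of_far_rpow (h : IsLocallyBoundedSolution φ r m) (hω : 1 < ω) (hω3 : ω ≤ 3)
    (hI : 0 ≤ I) (hC : 0 ≤ C) (hX : 0 ≤ X) (hu : 1 ≤ u) (huU : u ≤ U) (hUV : U < V) (hv : V ≤ v)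
    (hinit : ∀ s, V ≤ s → |dv (r * φ) 1 s| ≤ I * s ^ (-ω))
    (hpot : ∀ u s, 1 ≤ u → u ≤ U → V ≤ s →
      -potential r m u s * |φ u s| ≤ C * s ^ (-3 : ℝ) * |r u s * φ u s|)
    (hrphi : ∀ u s, 1 ≤ u → u ≤ U → V ≤ s → s ≤ v → |r u s * φ u s| ≤ X) :
    |r u v * φ u v| ≤
      |r u V * φ u V| + (I + C * U * X) * (V ^ (1 - ω) / (ω - 1)) := by
  have hU : 0 ≤ U := by linarith
  have hincr := h.abs_rphi_sub_le_of_rpow hu (by linarith) hv hω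
    (C := I + C * U * X) (by positivity) fun s hs =>
      h.abs_dv_rphi_le_of_far_rpow hω3 hC hX hu huU (by linarith [hs.1]) (hinit s hs.1.le)
        (fun u' hu' => hpot u' s hu'.1.le (hu'.2.le.trans huU) hs.1.le)
        fun u' hu' => hrphi u' s hu'.1.le (hu'.2.le.trans huU) hs.1.le hs.2.le
  linarith [abs_sub_abs_le_abs_sub (r u v * φ u v) (r u V * φ u V)]

end IsLocallyBoundedSolution

namespace IsLocallyBoundedScattering

theorem exists_neg_nu_le_of_le (h : IsLocallyBoundedScattering φ r m) (hU : 1 ≤ U) :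
    ∃ K : ℝ, 0 < K ∧ ∀ u v, 1 ≤ u → u ≤ U → u < v → -du r u v ≤ K := by
  obtain ⟨M, hM, -⟩ := h.exists_mass_bound
  obtain ⟨V, hV, hr⟩ := h.exists_forall_r_ge hU (4 * M 1)
  obtain ⟨C, hC⟩ := h.neg_nu_bdd V
  have hC0 : 0 < C :=
    (neg_pos.2 (h.nu_neg hU hV)).trans_le (hC U V hU hV le_rfl)
  refine ⟨Real.exp 1 * C, by positivity, fun u v hu huU huv => ?_⟩
  rcases le_or_gt v V with hv | hv
  · exact (hC u v hu huv hv).trans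
      (le_mul_of_one_le_left hC0.le (Real.one_le_exp zero_le_one))
  · have huV : u < V := huU.trans_lt hV
    calc -du r u v ≤ Real.exp 1 * -du r u V :=
          h.neg_nu_le_exp_one_mul hu huV hv.le
            ((h.m_anti_u le_rfl hu huv.le).trans (hM 1 v le_rfl (hu.trans huv.le)))
            (hr u V hu huU le_rfl)
      _ ≤ Real.exp 1 * C := by gcongr; exact hC u V hu huV le_rfl

theorem exists_potential_far_le (h : IsLocallyBoundedScattering φ r m) (hU : 1 ≤ U) :
    ∃ V C : ℝ, U < V ∧ 0 ≤ C ∧ ∀ u v, 1 ≤ u → u ≤ U → V ≤ v →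
      -potential r m u v * |φ u v| ≤ C * v ^ (-3 : ℝ) * |r u v * φ u v| := by
  obtain ⟨M, hM, -⟩ := h.exists_mass_bound
  obtain ⟨l, hl, hlam⟩ := h.exists_lam_ge
  obtain ⟨K, hK, hnu⟩ := h.exists_neg_nu_le_of_le hU
  have hM0 : 0 ≤ M 1 := (h.m_nonneg le_rfl le_rfl).trans (hM 1 1 le_rfl le_rfl)
  refine ⟨max (2 * U) (8 * M 1 / l), 16 * M 1 * K / l ^ 3,
    lt_max_of_lt_left (by linarith), by positivity, fun u v hu huU hv => ?_⟩
  obtain ⟨hUv, hMv⟩ := max_le_iff.1 hv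
  have huv : u < v := by linarith
  have hr := h.mul_sub_le_r_sub hu le_rfl huv.le fun s hs => hlam u s hu hs.1
  rw [h.r_axis u hu, sub_zero] at hr
  exact h.neg_potential_mul_abs_phi_le hu (by linarith) hl hr
    ((h.m_anti_u le_rfl hu huv.le).trans (hM 1 v le_rfl (hu.trans huv.le)))
    ((div_le_iff₀' hl).1 hMv) (hnu u v hu huU huv)

theorem exists_abs_rphi_le_of_le (h : IsLocallyBoundedScattering φ r m) (hω : 1 < ω)
    (hω3 : ω ≤ 3) (hI : 0 ≤ I) (hinit : ∀ v, 1 ≤ v → |dv (r * φ) 1 v| ≤ I * v ^ (-ω))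
    (hU : 1 ≤ U) :
    ∃ X : ℝ, 0 ≤ X ∧ ∀ u v, 1 ≤ u → u ≤ U → u ≤ v → |r u v * φ u v| ≤ X := by
  obtain ⟨V₀, C, hUV₀, hC, hpot⟩ := h.exists_potential_far_le hU
  have hlim : Tendsto (fun V : ℝ => (C * U) * (V ^ (1 - ω) / (ω - 1))) atTop (𝓝 0) := by
    have hpow := tendsto_rpow_neg_atTop (sub_pos.2 hω)
    simp only [neg_sub] at hpow
    simpa using (hpow.div_const (ω - 1)).const_mul (C * U)
  obtain ⟨V, hV₀, hsmall⟩ := ((eventually_ge_atTop V₀).and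
    (hlim.eventually_le_const (by norm_num : (0 : ℝ) < 1 / 2))).exists
  obtain ⟨D, hD, hnear⟩ := h.exists_abs_rphi_le V
  set B := D + I * (V ^ (1 - ω) / (ω - 1))
  have hB0 : 0 ≤ B := by
    have : 0 < ω - 1 := by linarith
    have : 0 < V := by linarith
    positivity
  have hfar : ∀ W, ∀ p ∈ {p : ℝ × ℝ | (1 ≤ p.1 ∧ p.1 ≤ U) ∧ V ≤ p.2 ∧ p.2 ≤ W},
      |r p.1 p.2 * φ p.1 p.2| ≤ 2 * B := by
    refine fun W p hp => le_two_mul_of_improvable (f := fun p => |r p.1 p.2 * φ p.1 p.2|) ?_ ?_ hp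
    · obtain ⟨D', -, hD'⟩ := h.exists_abs_rphi_le W
      exact ⟨D', by rintro _ ⟨p, ⟨⟨hu, huU⟩, hv, hvW⟩, rfl⟩; exact hD' _ _ hu (by linarith) hvW⟩
    · rintro X hX ⟨u, v⟩ ⟨⟨hu, huU⟩, hv, hvW⟩
      dsimp only at hu huU hv hvW ⊢
      have hX0 : 0 ≤ X := (abs_nonneg _).trans (hX (u, v) ⟨⟨hu, huU⟩, hv, hvW⟩)
      have hbound := h.abs_rphi_le_of_far_rpow hω hω3 hI hC hX0 hu huU (hUV₀.trans_le hV₀) hv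
        (fun s hs => hinit s (by linarith)) (fun u s hu huU hs => hpot u s hu huU (hV₀.trans hs))
        fun u s hu huU hs hsv => hX (u, s) ⟨⟨hu, huU⟩, hs, hsv.trans hvW⟩
      nlinarith [hnear u V hu (by linarith) le_rfl]
  refine ⟨D + 2 * B, by positivity, fun u v hu huU huv => ?_⟩
  rcases le_or_gt v V with hv | hv
  · linarith [hnear u v hu huv hv]
  · linarith [hfar v (u, v) ⟨⟨hu, huU⟩, hv.le, le_rfl⟩]

theorem exists_abs_dv_rphi_le_of_le (h : IsLocallyBoundedScattering φ r m) (hω : 1 < ω)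
    (hω3 : ω ≤ 3) (hI : 0 ≤ I) (hinit : ∀ v, 1 ≤ v → |dv (r * φ) 1 v| ≤ I * v ^ (-ω))
    (hU : 1 ≤ U) :
    ∃ C : ℝ, 0 ≤ C ∧ ∀ u v, 1 ≤ u → u ≤ U → u < v → |dv (r * φ) u v| ≤ C * v ^ (-ω) := by
  obtain ⟨X, hX0, hX⟩ := h.exists_abs_rphi_le_of_le hω hω3 hI hinit hU
  obtain ⟨V, C, hUV, hC, hpot⟩ := h.exists_potential_far_le hU
  obtain ⟨D, hD0, hD⟩ := h.exists_abs_dv_rphi_le_initial_add V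
  have hV : 0 < V := by linarith
  refine ⟨I + C * U * X + D * V ^ ω, by positivity, fun u v hu huU huv => ?_⟩
  have hv : 1 ≤ v := hu.trans huv.le
  have hv0 : 0 < v := by linarith
  rcases le_or_gt V v with hvV | hvV
  · refine (h.abs_dv_rphi_le_of_far_rpow hω3 hC hX0 hu huU huv (hinit v hv)
      (fun u' hu' => hpot u' v hu'.1.le (by linarith [hu'.2]) hvV)
      fun u' hu' => hX u' v hu'.1.le (by linarith [hu'.2]) (by linarith [hu'.2])).trans ?_
    exact mul_le_mul_of_nonneg_right (le_add_of_nonneg_right (by positivity)) (by positivity)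
  · have hone : 1 ≤ V ^ ω * v ^ (-ω) := by
      rw [Real.rpow_neg hv0.le, ← div_eq_mul_inv, one_le_div (by positivity)]
      gcongr
    calc |dv (r * φ) u v| ≤ |dv (r * φ) 1 v| + D := hD u v hu huv hvV.le
      _ ≤ I * v ^ (-ω) + D * (V ^ ω * v ^ (-ω)) :=
          add_le_add (hinit v hv) (le_mul_of_one_le_right hD0 hone)
      _ = (I + D * V ^ ω) * v ^ (-ω) := by ring
      _ ≤ (I + C * U * X + D * V ^ ω) * v ^ (-ω) := by
          gcongr
          exact le_add_of_nonneg_right (by positivity)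

end IsLocallyBoundedScattering

/-! ### Uniform bounds for `∂_v (r φ)` -/

namespace IsLocallyBoundedSolution

theorem abs_phi_le_div (h : IsLocallyBoundedSolution φ r m) (hu : 1 ≤ u) (huv : u < v)
    (hl : 0 < l) (hX : 0 ≤ X) (hlam : ∀ s ∈ Ioo u v, l ≤ dv r u s)
    (hf : ∀ s ∈ Ioo u v, |dv (r * φ) u s| ≤ X) : |φ u v| ≤ X / l :=
  h.abs_phi_le hu huv fun s hs =>
    calc |dv (r * φ) u s| ≤ X := hf s hs
      _ = X / l * l := by field_simp
      _ ≤ X / l * dv r u s := by gcongr; exact hlam s hs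

theorem abs_dv_rphi_le_add_half (h : IsLocallyBoundedSolution φ r m) (hl : 0 < l)
    (hlam : ∀ u v, 1 ≤ u → u < v → l ≤ dv r u v) (hU : 1 ≤ U) (huU : U ≤ u) (huv : u < v)
    (hlate : 1 / 2 - l / 2 ≤ dv r u v) (hX0 : 0 ≤ X)
    (hX : ∀ u' v', U ≤ u' → u' ≤ u → u' < v' → |dv (r * φ) u' v'| ≤ X) :
    |dv (r * φ) u v| ≤ |dv (r * φ) U v| + X / 2 := by
  have hincr := h.abs_dv_rphi_sub_le_lam hU huU huv fun u' hu' =>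
    h.abs_phi_le_div (hU.trans hu'.1.le) (hu'.2.trans huv) hl hX0
      (fun s hs => hlam u' s (hU.trans hu'.1.le) hs.1) fun s hs => hX u' s hu'.1.le hu'.2.le hs.1
  have hlam_incr : X / l * (dv r U v - dv r u v) ≤ X / 2 :=
    calc X / l * (dv r U v - dv r u v) ≤ X / l * (l / 2) := by
          gcongr
          linarith [h.lam_le_half hU (huU.trans_lt huv)]
      _ = X / 2 := by field_simp
  linarith [abs_sub_abs_le_abs_sub (dv (r * φ) u v) (dv (r * φ) U v)]

end IsLocallyBoundedSolution

namespace IsLocallyBoundedScattering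

theorem exists_abs_dv_rphi_le (h : IsLocallyBoundedScattering φ r m) (hω : 1 < ω) (hω3 : ω ≤ 3)
    (hI : 0 ≤ I) (hinit : ∀ v, 1 ≤ v → |dv (r * φ) 1 v| ≤ I * v ^ (-ω)) :
    ∃ F : ℝ, ∀ u v, 1 ≤ u → u < v → |dv (r * φ) u v| ≤ F := by
  obtain ⟨l, hl, hlam⟩ := h.exists_lam_ge
  have hl2 : l ≤ 1 / 2 :=
    (hlam 1 2 le_rfl one_lt_two).trans (h.lam_le_half le_rfl one_lt_two)
  obtain ⟨U₁, hU₁, hlate⟩ := h.exists_forall_lam_ge (l := 1 / 2 - l / 2) (by linarith)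
    (by linarith)
  have hbound : ∀ U, 1 ≤ U → ∃ C : ℝ, 0 ≤ C ∧
      ∀ u v, 1 ≤ u → u ≤ U → u < v → |dv (r * φ) u v| ≤ C := by
    intro U hU
    obtain ⟨C, hC, hdecay⟩ := h.exists_abs_dv_rphi_le_of_le hω hω3 hI hinit hU
    exact ⟨C, hC, fun u v hu huU huv => (hdecay u v hu huU huv).trans <|
      mul_le_of_le_one_right hC <|
        Real.rpow_le_one_of_one_le_of_nonpos (hu.trans huv.le) (by linarith)⟩
  obtain ⟨C, hC, hearly⟩ := hbound U₁ hU₁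
  have himproved : ∀ U, ∀ p ∈ {p : ℝ × ℝ | (U₁ ≤ p.1 ∧ p.1 ≤ U) ∧ p.1 < p.2},
      |dv (r * φ) p.1 p.2| ≤ 2 * C := by
    refine fun U p hp => le_two_mul_of_improvable (f := fun p => |dv (r * φ) p.1 p.2|) ?_ ?_ hp
    · obtain ⟨D, -, hD⟩ := hbound (max U 1) (le_max_right _ _)
      refine ⟨D, ?_⟩
      rintro _ ⟨p, ⟨⟨hu, huU⟩, huv⟩, rfl⟩
      exact hD _ _ (hU₁.trans hu) (huU.trans (le_max_left _ _)) huv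
    · rintro X hX ⟨u, v⟩ ⟨⟨hu, huU⟩, huv⟩
      dsimp only at hu huU huv ⊢
      refine (h.abs_dv_rphi_le_add_half hl hlam hU₁ hu huv (hlate u v hu huv)
        ((abs_nonneg _).trans (hX (u, v) ⟨⟨hu, huU⟩, huv⟩)) fun u' v' hu' hu'u huv' =>
          hX (u', v') ⟨⟨hu', hu'u.trans huU⟩, huv'⟩).trans ?_
      gcongr
      exact hearly U₁ v hU₁ le_rfl (hu.trans_lt huv)
  refine ⟨2 * C, fun u v hu huv => ?_⟩
  rcases le_or_gt u U₁ with huU | huU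
  · linarith [hearly u v hu huU huv]
  · exact himproved u (u, v) ⟨⟨huU.le, le_rfl⟩, huv⟩

end IsLocallyBoundedScattering

theorem abs_sub_le_variationOnFromTo_sub {f : ℝ → ℝ} {s : Set ℝ} {a x y : ℝ}
    (hf : LocallyBoundedVariationOn f s) (ha : a ∈ s) (hx : x ∈ s) (hy : y ∈ s) (hxy : x ≤ y) :
    |f y - f x| ≤ variationOnFromTo f s a y - variationOnFromTo f s a x := by
  rw [variationOnFromTo.sub_right hf ha hy hx, variationOnFromTo.eq_of_le f s hxy]
  exact abs_sub_le_of_eVariationOn_le (s := s ∩ Icc x y) ENNReal.toReal_nonneg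
    (ENNReal.ofReal_toReal (hf x y hx hy)).ge ⟨hy, hxy, le_rfl⟩ ⟨hx, le_rfl, hxy⟩

theorem variationOnFromTo_le {f : ℝ → ℝ} {s : Set ℝ} {a x : ℝ} (hδ : 0 ≤ δ)
    (hf : eVariationOn f s ≤ ENNReal.ofReal δ) : variationOnFromTo f s a x ≤ δ :=
  (le_abs_self _).trans <|
    (variationOnFromTo.abs_le_eVariationOn (hf.trans_lt ENNReal.ofReal_lt_top).ne).trans <|
      ENNReal.toReal_le_of_le_ofReal hδ hf

theorem abs_inv_sub_inv_le {x y : ℝ} (hl : 0 < l) (hx : l ≤ x) (hy : l ≤ y) :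
    |x⁻¹ - y⁻¹| ≤ l⁻¹ * |Real.log x - Real.log y| := by
  wlog hxy : x ≤ y generalizing x y
  · rw [abs_sub_comm, abs_sub_comm (Real.log x)]
    exact this hy hx (le_of_not_ge hxy)
  have hx0 : 0 < x := hl.trans_le hx
  have hy0 : 0 < y := hl.trans_le hy
  have hlog : 1 - x / y ≤ Real.log y - Real.log x := by
    rw [← Real.log_div hy0.ne' hx0.ne', ← inv_div]
    exact Real.one_sub_inv_le_log_of_pos (div_pos hy0 hx0)
  have hlog0 : 0 ≤ Real.log y - Real.log x := sub_nonneg.2 (Real.log_le_log hx0 hxy)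
  rw [abs_of_nonneg (sub_nonneg.2 (inv_anti₀ hx0 hxy)), abs_sub_comm, abs_of_nonneg hlog0]
  calc x⁻¹ - y⁻¹ = x⁻¹ * (1 - x / y) := by field_simp
    _ ≤ x⁻¹ * (Real.log y - Real.log x) := by gcongr
    _ ≤ l⁻¹ * (Real.log y - Real.log x) := by gcongr

theorem abs_div_sub_div_le {a b x y : ℝ} (hl : 0 < l) (hx : l ≤ x) (hy : l ≤ y) (hb : |b| ≤ F) :
    |a / x - b / y| ≤ l⁻¹ * |a - b| + F * l⁻¹ * |Real.log x - Real.log y| := by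
  have hF : 0 ≤ F := (abs_nonneg b).trans hb
  calc |a / x - b / y| = |x⁻¹ * (a - b) + b * (x⁻¹ - y⁻¹)| := by
        rw [div_eq_mul_inv, div_eq_mul_inv]; ring_nf
    _ ≤ x⁻¹ * |a - b| + |b| * |x⁻¹ - y⁻¹| :=
        (abs_add_le _ _).trans_eq (by
          rw [abs_mul, abs_mul, abs_of_pos (inv_pos.2 (hl.trans_le hx))])
    _ ≤ l⁻¹ * |a - b| + F * (l⁻¹ * |Real.log x - Real.log y|) := by
        gcongr
        exact abs_inv_sub_inv_le hl hx hy
    _ = l⁻¹ * |a - b| + F * l⁻¹ * |Real.log x - Real.log y| := by rw [mul_assoc F]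

/-- `T` controls the oscillation of `∂_v (r φ) / λ` on `C_u ∩ {v ≤ V}`. -/
structure ControlsOscillation (φ r : ℝ → ℝ → ℝ) (u V : ℝ) (T : ℝ → ℝ) : Prop where
  monotoneOn : MonotoneOn T (Icc u V)
  nonneg : ∀ s ∈ Icc u V, 0 ≤ T s
  abs_sub_le : ∀ s t, u < s → s ≤ t → t ≤ V →
    |dv (r * φ) u t / dv r u t - dv (r * φ) u s / dv r u s| ≤ T t - T s

theorem exists_controlsOscillation (huV : u ≤ V) (hl : 0 < l) (hF0 : 0 ≤ F) (hδ : 0 ≤ δ)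
    (hlam : ∀ v, u < v → l ≤ dv r u v) (hF : ∀ v, u < v → |dv (r * φ) u v| ≤ F)
    (hTVf : eVariationOn (fun v => dv (r * φ) u v) (Icc u V) ≤ ENNReal.ofReal δ)
    (hTVlog : eVariationOn (fun v => Real.log (dv r u v)) (Icc u V) ≤ ENNReal.ofReal δ) :
    ∃ T, ControlsOscillation φ r u V T ∧ T V ≤ l⁻¹ * δ + F * l⁻¹ * δ := by
  have hu : u ∈ Icc u V := ⟨le_rfl, huV⟩
  have hbv {f : ℝ → ℝ} (hf : eVariationOn f (Icc u V) ≤ ENNReal.ofReal δ) :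
      LocallyBoundedVariationOn f (Icc u V) :=
    BoundedVariationOn.locallyBoundedVariationOn (hf.trans_lt ENNReal.ofReal_lt_top).ne
  refine ⟨fun v => l⁻¹ * variationOnFromTo (fun v => dv (r * φ) u v) (Icc u V) u v +
    F * l⁻¹ * variationOnFromTo (fun v => Real.log (dv r u v)) (Icc u V) u v,
    ⟨fun s hs t ht hst => ?_, fun s hs => ?_, fun s t hs hst ht => ?_⟩, ?_⟩
  · have hf := variationOnFromTo.monotoneOn (hbv hTVf) hu hs ht hst
    have hlog := variationOnFromTo.monotoneOn (hbv hTVlog) hu hs ht hst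
    gcongr
  · have hf := variationOnFromTo.nonneg_of_le (fun v => dv (r * φ) u v) (Icc u V) hs.1
    have hlog := variationOnFromTo.nonneg_of_le (fun v => Real.log (dv r u v)) (Icc u V) hs.1
    positivity
  · have hsmem : s ∈ Icc u V := ⟨hs.le, hst.trans ht⟩
    have htmem : t ∈ Icc u V := ⟨hs.le.trans hst, ht⟩
    have hf := abs_sub_le_variationOnFromTo_sub (hbv hTVf) hu hsmem htmem hst
    have hlog := abs_sub_le_variationOnFromTo_sub (hbv hTVlog) hu hsmem htmem hst
    refine (abs_div_sub_div_le hl (hlam t (hs.trans_le hst)) (hlam s hs) (hF s hs)).trans ?_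
    refine (add_le_add (mul_le_mul_of_nonneg_left hf (inv_nonneg.2 hl.le))
      (mul_le_mul_of_nonneg_left hlog (mul_nonneg hF0 (inv_nonneg.2 hl.le)))).trans_eq ?_
    ring
  · dsimp only
    gcongr
    · exact variationOnFromTo_le hδ hTVf
    · exact variationOnFromTo_le hδ hTVlog

/-- The average of `T` over the part of `C_u` up to `v` with respect to `dr = λ dv`. -/
noncomputable def radialAverage (r : ℝ → ℝ → ℝ) (T : ℝ → ℝ) (u v : ℝ) : ℝ :=
  (∫ s in u..v, dv r u s * T s) / r u v

namespace IsLocallyBoundedSolution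

variable {T : ℝ → ℝ}

theorem intervalIntegrable_lam_mul (h : IsLocallyBoundedSolution φ r m) (hu : 1 ≤ u) (huV : u ≤ V)
    (hT : MonotoneOn T (Icc u V)) :
    IntervalIntegrable (fun s => dv r u s * T s) volume u V := by
  have hTint : IntervalIntegrable T volume u V :=
    MonotoneOn.intervalIntegrable (by rwa [uIcc_of_le huV])
  rw [intervalIntegrable_iff_integrableOn_Ioc_of_le huV] at hTint ⊢
  refine Integrable.bdd_mul (c := 1 / 2) hTint
    (aestronglyMeasurable_derivWithin_Ioi (fun v' => r u v') _) ?_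
  refine (ae_restrict_iff' measurableSet_Ioc).2 (Eventually.of_forall fun s hs => ?_)
  rw [Real.norm_eq_abs, abs_of_pos (h.lam_pos hu hs.1)]
  exact h.lam_le_half hu hs.1

theorem absolutelyContinuousOnInterval_integral_lam_mul (h : IsLocallyBoundedSolution φ r m)
    (hu : 1 ≤ u) (huV : u ≤ V) (hT : MonotoneOn T (Icc u V)) :
    AbsolutelyContinuousOnInterval (fun v => ∫ s in u..v, dv r u s * T s) u V :=
  (h.intervalIntegrable_lam_mul hu huV hT).absolutelyContinuousOnInterval_intervalIntegral
    left_mem_uIcc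

theorem ae_hasDerivAt_integral_lam_mul (h : IsLocallyBoundedSolution φ r m) (hu : 1 ≤ u)
    (huV : u ≤ V) (hT : MonotoneOn T (Icc u V)) :
    ∀ᵐ v, v ∈ Ioo u V →
      HasDerivAt (fun v => ∫ s in u..v, dv r u s * T s) (dv r u v * T v) v := by
  filter_upwards [(h.intervalIntegrable_lam_mul hu huV hT).ae_hasDerivAt_integral] with v hv hmem
  rw [uIcc_of_le huV] at hv
  exact hv (Ioo_subset_Icc_self hmem) u ⟨le_rfl, huV⟩

theorem radialAverage_ac (h : IsLocallyBoundedSolution φ r m) (hu : 1 ≤ u) (h₁ : u < v₁)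
    (h₂ : v₁ ≤ v₂) (hT : MonotoneOn T (Icc u v₂)) :
    AbsolutelyContinuousOnInterval (fun v => radialAverage r T u v) v₁ v₂ := by
  simp only [radialAverage, div_eq_mul_inv]
  refine (absolutelyContinuousOnInterval_mono_Icc
    (h.absolutelyContinuousOnInterval_integral_lam_mul hu (h₁.le.trans h₂) hT)
    h₁.le h₂ le_rfl).fun_mul
    (absolutelyContinuousOnInterval_inv (h.r_ac_v_of_le hu h₁.le h₂) fun v hv => ?_)
  rw [uIcc_of_le h₂] at hv
  exact h.r_pos u v hu (h₁.trans_le hv.1)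

theorem ae_hasDerivAt_radialAverage (h : IsLocallyBoundedSolution φ r m) (hu : 1 ≤ u)
    (huV : u ≤ V) (hT : MonotoneOn T (Icc u V)) :
    ∀ᵐ v, v ∈ Ioo u V → HasDerivAt (fun v => radialAverage r T u v)
      (dv r u v * (T v - radialAverage r T u v) / r u v) v := by
  filter_upwards [h.ae_hasDerivAt_integral_lam_mul hu huV hT, h.ae_hasDerivAt_r_v hu]
    with v hint hr hv
  have hr0 := (h.r_pos u v hu hv.1).ne'
  refine ((hint hv).fun_div (hr hv.1) hr0).congr_deriv ?_
  rw [radialAverage]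
  field_simp

theorem radialAverage_nonneg (h : IsLocallyBoundedSolution φ r m) (hu : 1 ≤ u) (huv : u ≤ v)
    (hT : ∀ s ∈ Icc u v, 0 ≤ T s) : 0 ≤ radialAverage r T u v := by
  refine div_nonneg ?_ (h.r_nonneg hu huv)
  rw [intervalIntegral.integral_of_le huv]
  exact setIntegral_nonneg measurableSet_Ioc fun s hs =>
    mul_nonneg (h.lam_pos hu hs.1).le (hT s (Ioc_subset_Icc_self hs))

/-- `φ` is the radial average of `∂_v (r φ) / λ`, so that its distance from the value of the latter
at `v` is at most the radial average of `T v - T`. -/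
theorem abs_dv_rphi_div_sub_phi_le (h : IsLocallyBoundedSolution φ r m) (hu : 1 ≤ u) (huv : u < v)
    (hT : ControlsOscillation φ r u v T) :
    |dv (r * φ) u v / dv r u v - φ u v| ≤ T v - radialAverage r T u v := by
  set g := dv (r * φ) u v / dv r u v
  have hr := h.r_pos u v hu huv
  have hle := abs_sub_le_sub_of_ae_hasDerivAt (f := fun s => g * r u s - (r * φ) u s)
    (g := fun s => T v * r u s - ∫ t in u..s, dv r u t * T t) huv.le
    (((h.r_ac_v u v hu huv.le).const_mul g).fun_sub (h.rphi_ac_v_of_le hu le_rfl huv.le))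
    (((h.r_ac_v u v hu huv.le).const_mul (T v)).fun_sub
      (h.absolutelyContinuousOnInterval_integral_lam_mul hu huv.le hT.monotoneOn)) <| by
    filter_upwards [h.ae_hasDerivAt_r_v hu, h.ae_hasDerivAt_rphi_v hu,
      h.ae_hasDerivAt_integral_lam_mul hu huv.le hT.monotoneOn] with s hrs hrφ hint hs
    refine ⟨_, _, ((hrs hs.1).const_mul g).fun_sub (hrφ hs.1),
      ((hrs hs.1).const_mul (T v)).fun_sub (hint hs), ?_⟩
    have hlam := h.lam_pos hu hs.1
    calc |g * dv r u s - dv (r * φ) u s|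
        = dv r u s * |g - dv (r * φ) u s / dv r u s| := by
          rw [← abs_of_pos hlam, ← abs_mul, abs_of_pos hlam]; congr 1; field_simp
      _ ≤ dv r u s * (T v - T s) := by gcongr; exact hT.abs_sub_le s v hs.1 hs.2.le le_rfl
      _ = T v * dv r u s - dv r u s * T s := by ring
  have haxis : (r * φ) u u = 0 := by simp [h.r_axis u hu]
  simp only [haxis, h.r_axis u hu, intervalIntegral.integral_same, mul_zero, sub_zero] at hle
  have hfactor : g * r u v - (r * φ) u v = (g - φ u v) * r u v := by
    simp only [Pi.mul_apply]; ring
  rw [hfactor, abs_mul, abs_of_pos hr, ← le_div_iff₀ hr, sub_div,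
    mul_div_cancel_right₀ _ hr.ne'] at hle
  exact hle

theorem ae_two_mul_dv_m_le_of_controlsOscillation (h : IsLocallyBoundedSolution φ r m)
    (hu : 1 ≤ u) (hH : ∀ s ∈ Ioo u V, |dv (r * φ) u s| ≤ H * dv r u s)
    (hT : ControlsOscillation φ r u V T) :
    ∀ᵐ v, v ∈ Ioo u V →
      2 * dv m u v ≤ dv r u v * (2 * H * (T v - radialAverage r T u v)) := by
  filter_upwards [h.ae_two_mul_dv_m hu] with v heq hv
  have hlam := h.lam_pos hu hv.1
  have hμ : 1 - massRatio r m u v ≤ 1 := by linarith [h.massRatio_nonneg hu hv.1]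
  set x := dv (r * φ) u v / dv r u v - φ u v
  have hosc : |x| ≤ T v - radialAverage r T u v :=
    h.abs_dv_rphi_div_sub_phi_le hu hv.1 ⟨hT.monotoneOn.mono (Icc_subset_Icc_right hv.2.le),
      fun s hs => hT.nonneg s (Icc_subset_Icc_right hv.2.le hs),
      fun s t hs hst ht => hT.abs_sub_le s t hs hst (ht.trans hv.2.le)⟩
  have hbound : |x| ≤ 2 * H := by
    have hφ : |φ u v| ≤ H := h.abs_phi_le hu hv.1 fun s hs => hH s ⟨hs.1, hs.2.trans hv.2⟩
    have hratio : |dv (r * φ) u v / dv r u v| ≤ H := by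
      rw [abs_div, abs_of_pos hlam, div_le_iff₀ hlam]
      exact hH v hv
    exact (abs_sub _ _).trans (by linarith)
  calc 2 * dv m u v = (1 - massRatio r m u v) * (dv r u v * x ^ 2) := heq hv.1
    _ ≤ 1 * (dv r u v * x ^ 2) := by gcongr
    _ = dv r u v * (|x| * |x|) := by rw [one_mul, ← sq_abs x, sq]
    _ ≤ dv r u v * (2 * H * (T v - radialAverage r T u v)) := by
        have hH0 := (abs_nonneg x).trans hbound
        gcongr

theorem massRatio_ac (h : IsLocallyBoundedSolution φ r m) (hu : 1 ≤ u) (h₁ : u < v₁)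
    (h₂ : v₁ ≤ v₂) : AbsolutelyContinuousOnInterval (fun v => massRatio r m u v) v₁ v₂ := by
  simp only [massRatio, div_eq_mul_inv]
  refine ((h.m_ac_v_of_le hu h₁.le h₂).const_mul 2).fun_mul
    (absolutelyContinuousOnInterval_inv (h.r_ac_v_of_le hu h₁.le h₂) fun v hv => ?_)
  rw [uIcc_of_le h₂] at hv
  exact h.r_pos u v hu (h₁.trans_le hv.1)

theorem ae_hasDerivAt_massRatio_v (h : IsLocallyBoundedSolution φ r m) (hu : 1 ≤ u) :
    ∀ᵐ v, v ∈ Ioi u → HasDerivAt (fun v => massRatio r m u v)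
      ((2 * dv m u v - massRatio r m u v * dv r u v) / r u v) v := by
  filter_upwards [h.ae_hasDerivAt_m_v hu, h.ae_hasDerivAt_r_v hu] with v hm hr hv
  have hr0 := (h.r_pos u v hu hv).ne'
  refine (((hm hv).const_mul 2).fun_div (hr hv) hr0).congr_deriv ?_
  rw [massRatio]
  field_simp

theorem neg_potential_le_of_inv_le (h : IsLocallyBoundedSolution φ r m) (hu : 1 ≤ u) (huv : u < v)
    (hK : 0 < K) (hμ : K⁻¹ ≤ 1 - massRatio r m u v) :
    -potential r m u v ≤ K * (massRatio r m u v * dv r u v / r u v) * -du r u v := by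
  have hr := h.r_pos u v hu huv
  have hlam := h.lam_pos hu huv
  have hν := neg_pos.2 (h.nu_neg hu huv)
  have hμ0 := h.massRatio_nonneg hu huv
  have hinv : (1 - massRatio r m u v)⁻¹ ≤ K := inv_le_of_inv_le₀ hK hμ
  calc -potential r m u v
      = (1 - massRatio r m u v)⁻¹ * (massRatio r m u v * dv r u v / r u v) * -du r u v := by
        rw [potential, div_mul_eq_div_div_swap]
        ring
    _ ≤ _ := by gcongr

/-- `∂_v log (-ν) ≤ N μ λ / r`, whereas `∂_v μ = (2 ∂_v m - μ λ) / r` and the contribution of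
`2 ∂_v m` is absorbed by the derivative of the radial average of `T`. -/
theorem log_neg_nu_sub_le (h : IsLocallyBoundedSolution φ r m) (hu : 1 ≤ u) (h₁ : u < v₁)
    (h₂ : v₁ ≤ v₂) (hH : ∀ v, u < v → |dv (r * φ) u v| ≤ H * dv r u v)
    (hT : ControlsOscillation φ r u v₂ T) :
    Real.log (-du r u v₂) - Real.log (-du r u v₁) ≤
      (1 + 4 * H ^ 2) * (2 * H * radialAverage r T u v₂ - massRatio r m u v₂) -
        (1 + 4 * H ^ 2) * (2 * H * radialAverage r T u v₁ - massRatio r m u v₁) := by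
  have hN : 0 < 1 + 4 * H ^ 2 := by positivity
  refine sub_le_sub_of_ae_hasDerivAt_le (f := fun v => Real.log (-du r u v))
    (g := fun v => (1 + 4 * H ^ 2) * (2 * H * radialAverage r T u v - massRatio r m u v)) h₂
    (absolutelyContinuousOnInterval_log (h.nu_ac u v₁ v₂ hu h₁ h₂).fun_neg fun v hv => ?_)
    ((((h.radialAverage_ac hu h₁ h₂ hT.monotoneOn).const_mul (2 * H)).fun_sub
      (h.massRatio_ac hu h₁ h₂)).const_mul (1 + 4 * H ^ 2)) ?_
  · rw [uIcc_of_le h₂] at hv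
    exact neg_pos.2 (h.nu_neg hu (h₁.trans_le hv.1))
  filter_upwards [h.ae_hasDerivAt_nu_v hu,
    h.ae_hasDerivAt_radialAverage hu (h₁.le.trans h₂) hT.monotoneOn,
    h.ae_hasDerivAt_massRatio_v hu,
    h.ae_two_mul_dv_m_le_of_controlsOscillation hu (fun s hs => hH s hs.1) hT]
    with v hν havg hμ hm hv
  have huv : u < v := h₁.trans hv.1
  have hr := h.r_pos u v hu huv
  have hν0 := neg_pos.2 (h.nu_neg hu huv)
  refine ⟨_, _, (hν huv).fun_neg.log hν0.ne',
    (((havg ⟨huv, hv.2⟩).const_mul (2 * H)).fun_sub (hμ huv)).const_mul _, ?_⟩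
  rw [div_le_iff₀ hν0]
  refine (h.neg_potential_le_of_inv_le hu huv hN
    (h.inv_le_one_sub_massRatio hu huv fun s hs => hH s hs.1)).trans ?_
  gcongr
  rw [← mul_div_assoc, ← sub_div]
  gcongr
  linarith [hm ⟨huv, hv.2⟩]

theorem exists_neg_nu_le_one (h : IsLocallyBoundedSolution φ r m) (hu : 1 ≤ u) (huV : u < V) :
    ∃ v, u < v ∧ v < V ∧ -du r u v ≤ 1 := by
  obtain ⟨ε, hν, hε⟩ := (((h.nu_add_lam_axis u hu).eventually
    (lt_mem_nhds (show (-(1 / 2) : ℝ) < 0 by norm_num))).and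
    (Ioo_mem_nhdsGT (sub_pos.2 huV))).exists
  have huv : u < u + ε := lt_add_of_pos_right u hε.1
  exact ⟨u + ε, huv, by linarith [hε.2], by linarith [h.lam_le_half hu huv]⟩

theorem neg_nu_le_of_controlsOscillation (h : IsLocallyBoundedSolution φ r m) (hu : 1 ≤ u)
    (huV : u < V) (hH : ∀ v, u < v → |dv (r * φ) u v| ≤ H * dv r u v)
    (hT : ControlsOscillation φ r u V T) :
    -du r u V ≤ Real.exp ((1 + 4 * H ^ 2) * (1 + 2 * H * T V)) := by
  obtain ⟨v, huv, hvV, hν⟩ := h.exists_neg_nu_le_one hu huV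
  have hν0 := neg_pos.2 (h.nu_neg hu huv)
  have hH0 : 0 ≤ H := (abs_nonneg _).trans (h.abs_phi_le hu huv fun s hs => hH s hs.1)
  have hlog := h.log_neg_nu_sub_le hu huv hvV.le hH hT
  have hlog0 : Real.log (-du r u v) ≤ 0 := Real.log_nonpos hν0.le hν
  have havgV : radialAverage r T u V ≤ T V :=
    sub_nonneg.1 ((abs_nonneg _).trans (h.abs_dv_rphi_div_sub_phi_le hu huV hT))
  have havg : 0 ≤ radialAverage r T u v :=
    h.radialAverage_nonneg hu huv.le fun s hs => hT.nonneg s (Icc_subset_Icc_right hvV.le hs)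
  have hμV := h.massRatio_nonneg hu huV
  have hμ := h.one_sub_massRatio_pos hu huv
  rw [← Real.log_le_iff_le_exp (neg_pos.2 (h.nu_neg hu huV))]
  calc Real.log (-du r u V)
      ≤ (1 + 4 * H ^ 2) * (massRatio r m u v - massRatio r m u V +
          2 * H * radialAverage r T u V - 2 * H * radialAverage r T u v) := by linarith
    _ ≤ (1 + 4 * H ^ 2) * (1 - 0 + 2 * H * T V - 2 * H * 0) := by gcongr; linarith
    _ = (1 + 4 * H ^ 2) * (1 + 2 * H * T V) := by ring

end IsLocallyBoundedSolution

namespace IsLocallyBoundedScattering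

theorem exists_neg_nu_le_of_ge (h : IsLocallyBoundedScattering φ r m)
    (hF : ∀ u v, 1 ≤ u → u < v → |dv (r * φ) u v| ≤ F) :
    ∃ U K, 1 ≤ U ∧ ∀ u v, U ≤ u → u < v → -du r u v ≤ K := by
  obtain ⟨R, hR, hTVf, hTVlog⟩ := h.scattering
  obtain ⟨M, hM, hM0⟩ := h.exists_mass_bound
  obtain ⟨l, hl, hlam⟩ := h.exists_lam_ge
  have hF0 : 0 ≤ F := (abs_nonneg _).trans (hF 1 2 le_rfl one_lt_two)
  obtain ⟨U, hU⟩ := eventually_atTop.1 <|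
    (ENNReal.tendsto_nhds_zero.1 hTVf (ENNReal.ofReal 1) (by simp)).and <|
    (ENNReal.tendsto_nhds_zero.1 hTVlog (ENNReal.ofReal 1) (by simp)).and <|
    (hM0.eventually (ge_mem_nhds (show (0 : ℝ) < R / 4 by positivity)))
  set K := Real.exp ((1 + 4 * (F / l) ^ 2) * (1 + 2 * (F / l) * (l⁻¹ * 1 + F * l⁻¹ * 1)))
  refine ⟨max U 1, Real.exp 1 * K, le_max_right _ _, fun u v hUu huv => ?_⟩
  have hu : 1 ≤ u := (le_max_right _ _).trans hUu
  obtain ⟨htvf, htvlog, hMu⟩ := hU u ((le_max_left _ _).trans hUu)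
  obtain ⟨w, huw, hw⟩ := h.exists_r_eq hu le_rfl (R := R) (by rw [h.r_axis u hu]; exact hR.le)
  have huw' : u < w := huw.lt_of_ne fun heq => by
    rw [← heq, h.r_axis u hu] at hw
    exact hR.ne hw
  have hsub : Icc u w ⊆ {v | u ≤ v ∧ r u v ≤ R} := fun s hs =>
    ⟨hs.1, hw ▸ h.r_mono_v hu hs.1 hs.2⟩
  obtain ⟨T, hT, hTw⟩ := exists_controlsOscillation huw hl hF0 zero_le_one
    (fun v hv => hlam u v hu hv) (fun v hv => hF u v hu hv)
    ((eVariationOn.mono _ hsub).trans htvf) ((eVariationOn.mono _ hsub).trans htvlog)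
  have hKw : -du r u w ≤ K := by
    refine (h.neg_nu_le_of_controlsOscillation (H := F / l) hu huw' (fun v hv => ?_) hT).trans
      (Real.exp_le_exp.2 (by gcongr))
    calc |dv (r * φ) u v| ≤ F / l * l := by rw [div_mul_cancel₀ _ hl.ne']; exact hF u v hu hv
      _ ≤ F / l * dv r u v := by gcongr; exact hlam u v hu hv
  rcases le_or_gt v w with hv | hv
  · calc -du r u v ≤ -du r u w := neg_le_neg (h.nu_anti hu huv hv)
      _ ≤ 1 * K := by rwa [one_mul]
      _ ≤ Real.exp 1 * K := by gcongr; exact Real.one_le_exp zero_le_one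
  · refine (h.neg_nu_le_exp_one_mul hu huw' hv.le (hM u v hu huv.le) (by linarith)).trans ?_
    gcongr

theorem exists_neg_nu_le (h : IsLocallyBoundedScattering φ r m)
    (hF : ∀ u v, 1 ≤ u → u < v → |dv (r * φ) u v| ≤ F) :
    ∃ K : ℝ, 0 < K ∧ ∀ u v, 1 ≤ u → u < v → -du r u v ≤ K := by
  obtain ⟨U, K₁, hU, hK₁⟩ := h.exists_neg_nu_le_of_ge hF
  obtain ⟨K₂, hK₂0, hK₂⟩ := h.exists_neg_nu_le_of_le hU
  refine ⟨max K₁ K₂, lt_max_of_lt_right hK₂0, fun u v hu huv => ?_⟩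
  rcases le_total U u with hUu | huU
  · exact (hK₁ u v hUu huv).trans (le_max_left _ _)
  · exact (hK₂ u v hu huU huv).trans (le_max_right _ _)

end IsLocallyBoundedScattering

/-! ### Decay of `∂_v (r φ)` -/

theorem rpow_mul_le_iff_le_mul_rpow_neg {v x X ω : ℝ} (hv : 0 < v) :
    v ^ ω * x ≤ X ↔ x ≤ X * v ^ (-ω) := by
  rw [Real.rpow_neg hv.le, ← div_eq_mul_inv, le_div_iff₀' (by positivity)]

namespace IsLocallyBoundedSolution

theorem abs_phi_le_of_rpow (h : IsLocallyBoundedSolution φ r m) (hu : 1 ≤ u) (huv : u < v)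
    (hl : 0 < l) (hX : 0 ≤ X) (hω : 0 ≤ ω) (hlam : ∀ s, u < s → l ≤ dv r u s)
    (hf : ∀ s, u < s → |dv (r * φ) u s| ≤ X * s ^ (-ω)) : |φ u v| ≤ X / l * u ^ (-ω) := by
  have hu0 : 0 < u := by linarith
  rw [div_mul_eq_mul_div]
  refine h.abs_phi_le_div hu huv hl (by positivity) (fun s hs => hlam s hs.1) fun s hs =>
    (hf s hs.1).trans ?_
  gcongr ?_ * ?_
  exact Real.rpow_le_rpow_of_nonpos hu0 hs.1.le (by linarith)

theorem abs_rphi_le_of_rpow (h : IsLocallyBoundedSolution φ r m) (hu : 1 ≤ u) (huv : u < v)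
    (hX : 0 ≤ X) (hω : 1 < ω) (hf : ∀ s, u < s → |dv (r * φ) u s| ≤ X * s ^ (-ω)) :
    |r u v * φ u v| ≤ X / (ω - 1) * u ^ (-(ω - 1)) := by
  have hle := h.abs_rphi_sub_le_of_rpow hu le_rfl huv.le hω hX fun s hs => hf s hs.1
  rw [h.r_axis u hu, zero_mul, sub_zero] at hle
  calc |r u v * φ u v| ≤ X * (u ^ (1 - ω) / (ω - 1)) := hle
    _ = X / (ω - 1) * u ^ (-(ω - 1)) := by rw [neg_sub]; ring

theorem neg_potential_mul_abs_phi_le_of_le_two_mul (h : IsLocallyBoundedSolution φ r m)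
    (hu : 1 ≤ u) (huv : u < v) (hv : v ≤ 2 * u) (hl : 0 < l) (hX : 0 ≤ X) (hω : 0 ≤ ω)
    (hω3 : ω ≤ 3) (hlam : ∀ s, u < s → l ≤ dv r u s)
    (hf : ∀ s, u < s → |dv (r * φ) u s| ≤ X * s ^ (-ω)) :
    -potential r m u v * |φ u v| ≤ 8 / l * X * v ^ (-ω) * -potential r m u v := by
  have hv0 : 0 < v := by linarith
  have hp := neg_nonneg.2 (h.potential_nonpos hu huv)
  have hweight : u ^ (-ω) ≤ 8 * v ^ (-ω) :=
    calc u ^ (-ω) ≤ (v / 2) ^ (-ω) :=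
          Real.rpow_le_rpow_of_nonpos (by positivity) (by linarith) (by linarith)
      _ = 2 ^ ω * v ^ (-ω) := by
          rw [Real.div_rpow hv0.le (by norm_num), Real.rpow_neg (by norm_num : (0 : ℝ) ≤ 2),
            div_inv_eq_mul, mul_comm]
      _ ≤ 2 ^ (3 : ℝ) * v ^ (-ω) := by
          gcongr
          norm_num
      _ = 8 * v ^ (-ω) := by norm_num
  calc -potential r m u v * |φ u v| ≤ -potential r m u v * (X / l * u ^ (-ω)) := by
        gcongr
        exact h.abs_phi_le_of_rpow hu huv hl hX hω hlam hf
    _ ≤ -potential r m u v * (X / l * (8 * v ^ (-ω))) := by gcongr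
    _ = _ := by ring

theorem neg_potential_mul_abs_phi_le_of_two_mul_le (h : IsLocallyBoundedSolution φ r m)
    (hu : 1 ≤ u) (hv : 2 * u ≤ v) (hl : 0 < l) (hX : 0 ≤ X) (hω : 1 < ω) (hω3 : ω ≤ 3)
    (hlam : ∀ s, u < s → l ≤ dv r u s)
    (hf : ∀ s, u < s → |dv (r * φ) u s| ≤ X * s ^ (-ω)) (hM : m u v ≤ M) (hMv : 8 * M ≤ l * v)
    (hK : -du r u v ≤ K) :
    -potential r m u v * |φ u v| ≤
      16 * M * K / l ^ 3 / (ω - 1) * X * v ^ (-ω) * (u ^ 2)⁻¹ := by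
  have hu0 : 0 < u := by linarith
  have hv0 : 0 < v := by linarith
  have huv : u < v := by linarith
  have hω1 : 0 < ω - 1 := by linarith
  have hM0 := (h.m_nonneg hu huv.le).trans hM
  have hK0 : 0 ≤ K := by linarith [h.nu_neg hu huv]
  have hr := h.mul_sub_le_r_sub hu le_rfl huv.le fun s hs => hlam s hs.1
  rw [h.r_axis u hu, sub_zero] at hr
  have hweight : u ^ (-(ω - 1)) ≤ (u ^ 2)⁻¹ * v ^ (3 - ω) :=
    calc u ^ (-(ω - 1)) = (u ^ 2)⁻¹ * u ^ (3 - ω) := by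
          rw [← Real.rpow_two, ← Real.rpow_neg hu0.le, ← Real.rpow_add hu0]
          ring_nf
      _ ≤ (u ^ 2)⁻¹ * v ^ (3 - ω) := by gcongr
  have hpow : v ^ (-3 : ℝ) * v ^ (3 - ω) = v ^ (-ω) := by
    rw [← Real.rpow_add hv0]
    ring_nf
  calc -potential r m u v * |φ u v|
      ≤ 16 * M * K / l ^ 3 * v ^ (-3 : ℝ) * |r u v * φ u v| :=
        h.neg_potential_mul_abs_phi_le hu hv hl hr hM hMv hK
    _ ≤ 16 * M * K / l ^ 3 * v ^ (-3 : ℝ) * (X / (ω - 1) * ((u ^ 2)⁻¹ * v ^ (3 - ω))) := by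
        gcongr
        exact (h.abs_rphi_le_of_rpow hu huv hX hω hf).trans (by gcongr)
    _ = 16 * M * K / l ^ 3 / (ω - 1) * X * (v ^ (-3 : ℝ) * v ^ (3 - ω)) * (u ^ 2)⁻¹ := by ring
    _ = _ := by rw [hpow]

theorem neg_potential_mul_abs_phi_le_of_rpow (h : IsLocallyBoundedSolution φ r m)
    (hu : 1 ≤ u) (huv : u < v) (hl : 0 < l) (hX : 0 ≤ X) (hω : 1 < ω) (hω3 : ω ≤ 3)
    (hlam : ∀ s, u < s → l ≤ dv r u s)
    (hf : ∀ s, u < s → |dv (r * φ) u s| ≤ X * s ^ (-ω)) (hM : m u v ≤ M) (hMv : 8 * M ≤ l * v)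
    (hK : -du r u v ≤ K) :
    -potential r m u v * |φ u v| ≤
      (8 / l + 16 * M * K / l ^ 3 / (ω - 1)) * X * v ^ (-ω) * ((u ^ 2)⁻¹ - potential r m u v) := by
  have hv0 : 0 < v := by linarith
  have hω1 : 0 < ω - 1 := by linarith
  have hp := neg_nonneg.2 (h.potential_nonpos hu huv)
  have hM0 := (h.m_nonneg hu huv.le).trans hM
  have hK0 : 0 ≤ K := by linarith [h.nu_neg hu huv]
  rw [sub_eq_add_neg]
  rcases le_total v (2 * u) with hv | hv
  · refine (h.neg_potential_mul_abs_phi_le_of_le_two_mul hu huv hv hl hX (by linarith) hω3 hlam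
      hf).trans ?_
    gcongr
    · exact le_add_of_nonneg_right (by positivity)
    · exact le_add_of_nonneg_left (by positivity)
  · refine (h.neg_potential_mul_abs_phi_le_of_two_mul_le hu hv hl hX hω hω3 hlam hf hM hMv
      hK).trans ?_
    gcongr
    · exact le_add_of_nonneg_left (by positivity)
    · exact le_add_of_nonneg_right hp

theorem abs_dv_rphi_le_add (h : IsLocallyBoundedSolution φ r m) (hU : 1 ≤ U) (hUu : U ≤ u)
    (huv : u < v) (hC : 0 ≤ C)
    (hpot : ∀ s ∈ Ioo U u, -potential r m s v * |φ s v| ≤ C * ((s ^ 2)⁻¹ - potential r m s v)) :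
    |dv (r * φ) u v| ≤ |dv (r * φ) U v| + C * (U⁻¹ + (dv r U v - dv r u v)) := by
  have hac : AbsolutelyContinuousOnInterval (fun s => -s⁻¹ - dv r s v) U u :=
    (absolutelyContinuousOnInterval_inv (absolutelyContinuousOnInterval_id U u) fun s hs => by
      rw [uIcc_of_le hUu] at hs
      linarith [hs.1]).fun_neg.fun_sub (h.lam_ac_of_le hU hUu huv)
  have hincr := h.abs_dv_rphi_sub_le hU hUu huv (hac.const_mul C) <| by
    filter_upwards [h.ae_hasDerivAt_lam_u (v := v) (by linarith)] with s hlam hs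
    have hs0 : s ≠ 0 := by linarith [hs.1]
    refine ⟨_, ((hasDerivAt_inv hs0).fun_neg.fun_sub
      (hlam ⟨hU.trans_lt hs.1, hs.2.trans huv⟩)).const_mul C, ?_⟩
    rw [neg_neg]
    exact hpot s hs
  have hu : 0 ≤ C * u⁻¹ := mul_nonneg hC (inv_nonneg.2 (by linarith))
  linarith [abs_sub_abs_le_abs_sub (dv (r * φ) u v) (dv (r * φ) U v)]

end IsLocallyBoundedSolution

namespace IsLocallyBoundedScattering

theorem exists_forall_mul_inv_add_lam_sub_le (h : IsLocallyBoundedScattering φ r m) (V : ℝ)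
    {A : ℝ} (hA : 0 < A) (hε : 0 < ε) : ∃ U, 1 ≤ U ∧ V ≤ U ∧
      ∀ u v, U ≤ u → u < v → A * (U⁻¹ + (dv r U v - dv r u v)) ≤ ε := by
  set η := min (ε / (2 * A)) (1 / 4)
  have hη : 0 < η := by positivity
  have hη4 : η ≤ 1 / 4 := min_le_right _ _
  obtain ⟨U₀, hU₀, hlam⟩ :=
    h.exists_forall_lam_ge (l := 1 / 2 - η) (by linarith) (by linarith)
  set U := max (max U₀ V) η⁻¹
  have hUU₀ : U₀ ≤ U := (le_max_left _ _).trans (le_max_left _ _)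
  have hU : 1 ≤ U := hU₀.trans hUU₀
  refine ⟨U, hU, (le_max_right _ _).trans (le_max_left _ _), fun u v hu huv => ?_⟩
  have hinv : U⁻¹ ≤ η := inv_le_of_inv_le₀ hη (le_max_right _ _)
  have hsub : dv r U v - dv r u v ≤ η := by
    linarith [h.lam_le_half hU (hu.trans_lt huv), hlam u v (hUU₀.trans hu) huv]
  calc A * (U⁻¹ + (dv r U v - dv r u v)) ≤ A * (ε / (2 * A) + ε / (2 * A)) := by
        gcongr
        · exact hinv.trans (min_le_left _ _)
        · exact hsub.trans (min_le_left _ _)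
    _ = ε := by field_simp; ring

theorem exists_abs_dv_rphi_le_rpow_add_half (h : IsLocallyBoundedScattering φ r m) (hω : 1 < ω)
    (hω3 : ω ≤ 3) (hl : 0 < l) (hlam : ∀ u v, 1 ≤ u → u < v → l ≤ dv r u v) (hK : 0 < K)
    (hnu : ∀ u v, 1 ≤ u → u < v → -du r u v ≤ K) :
    ∃ U, 1 ≤ U ∧ ∀ u v X, U ≤ u → u < v → 0 ≤ X →
      (∀ s t, U ≤ s → s ≤ u → s < t → |dv (r * φ) s t| ≤ X * t ^ (-ω)) →
      |dv (r * φ) u v| ≤ |dv (r * φ) U v| + X / 2 * v ^ (-ω) := by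
  obtain ⟨M, hM, -⟩ := h.exists_mass_bound
  have hM1 : 0 ≤ M 1 := (h.m_nonneg le_rfl le_rfl).trans (hM 1 1 le_rfl le_rfl)
  have hω1 : 0 < ω - 1 := by linarith
  set A := 8 / l + 16 * M 1 * K / l ^ 3 / (ω - 1)
  obtain ⟨U, hU, hMU, hsmall⟩ := h.exists_forall_mul_inv_add_lam_sub_le (8 * M 1 / l)
    (A := A) (by positivity) one_half_pos
  rw [div_le_iff₀' hl] at hMU
  refine ⟨U, hU, fun u v X hu huv hX hf => ?_⟩
  have hv : 1 ≤ v := (hU.trans hu).trans huv.le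
  have hUv : U ≤ v := hu.trans huv.le
  refine (h.abs_dv_rphi_le_add hU hu huv (C := A * X * v ^ (-ω)) (by positivity)
    fun s hs => ?_).trans ?_
  · have hs1 : 1 ≤ s := hU.trans hs.1.le
    have hsv : s < v := hs.2.trans huv
    exact h.neg_potential_mul_abs_phi_le_of_rpow hs1 hsv hl hX hω hω3
      (fun t => hlam s t hs1) (fun t => hf s t hs.1.le hs.2.le)
      ((h.m_anti_u le_rfl hs1 hsv.le).trans (hM 1 v le_rfl hv))
      (hMU.trans (by gcongr)) (hnu s v hs1 hsv)
  · refine add_le_add_right ?_ _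
    calc A * X * v ^ (-ω) * (U⁻¹ + (dv r U v - dv r u v))
        = X * v ^ (-ω) * (A * (U⁻¹ + (dv r U v - dv r u v))) := by ring
      _ ≤ X * v ^ (-ω) * (1 / 2) := by gcongr; exact hsmall u v hu huv
      _ = X / 2 * v ^ (-ω) := by ring

theorem exists_abs_dv_rphi_le_rpow (h : IsLocallyBoundedScattering φ r m) (hω : 1 < ω)
    (hω3 : ω ≤ 3) (hI : 0 ≤ I) (hinit : ∀ v, 1 ≤ v → |dv (r * φ) 1 v| ≤ I * v ^ (-ω))
    (hl : 0 < l) (hlam : ∀ u v, 1 ≤ u → u < v → l ≤ dv r u v) (hK : 0 < K)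
    (hnu : ∀ u v, 1 ≤ u → u < v → -du r u v ≤ K) :
    ∃ B : ℝ, 0 ≤ B ∧ ∀ u v, 1 ≤ u → u < v → |dv (r * φ) u v| ≤ B * v ^ (-ω) := by
  obtain ⟨U₁, hU₁, himprove⟩ :=
    h.exists_abs_dv_rphi_le_rpow_add_half hω hω3 hl hlam hK hnu
  obtain ⟨C, hC, hearly⟩ := h.exists_abs_dv_rphi_le_of_le hω hω3 hI hinit hU₁
  have hlate : ∀ U, ∀ p ∈ {p : ℝ × ℝ | (U₁ ≤ p.1 ∧ p.1 ≤ U) ∧ p.1 < p.2},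
      p.2 ^ ω * |dv (r * φ) p.1 p.2| ≤ 2 * C := by
    refine fun U p hp =>
      le_two_mul_of_improvable (f := fun p => p.2 ^ ω * |dv (r * φ) p.1 p.2|) ?_ ?_ hp
    · obtain ⟨D, -, hD⟩ := h.exists_abs_dv_rphi_le_of_le hω hω3 hI hinit (le_max_right U 1)
      refine ⟨D, ?_⟩
      rintro _ ⟨⟨u, v⟩, ⟨⟨hu, huU⟩, huv⟩, rfl⟩
      dsimp only at hu huU huv ⊢
      exact (rpow_mul_le_iff_le_mul_rpow_neg (by linarith)).2
        (hD u v (hU₁.trans hu) (huU.trans (le_max_left _ _)) huv)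
    · rintro X hX ⟨u, v⟩ ⟨⟨hu, huU⟩, huv⟩
      dsimp only at hu huU huv ⊢
      have hv0 : 0 < v := by linarith
      have hX0 : 0 ≤ X := le_trans (by positivity) (hX (u, v) ⟨⟨hu, huU⟩, huv⟩)
      rw [rpow_mul_le_iff_le_mul_rpow_neg hv0, add_mul]
      refine (himprove u v X hu huv hX0 fun s t hs hsu hst =>
        (rpow_mul_le_iff_le_mul_rpow_neg (by linarith)).1
          (hX (s, t) ⟨⟨hs, hsu.trans huU⟩, hst⟩)).trans ?_
      gcongr
      exact hearly U₁ v hU₁ le_rfl (hu.trans_lt huv)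
  refine ⟨2 * C, by positivity, fun u v hu huv => ?_⟩
  have hv0 : 0 < v := by linarith
  rcases le_or_gt u U₁ with hle | hgt
  · refine (hearly u v hu hle huv).trans ?_
    gcongr
    linarith
  · exact (rpow_mul_le_iff_le_mul_rpow_neg hv0).1 (hlate u (u, v) ⟨⟨hgt.le, le_rfl⟩, huv⟩)

end IsLocallyBoundedScattering

/-! ### The axis and `∂_u (r φ)` -/

theorem IsSolution.abs_phi_axis_le (h : IsSolution φ r m) (hu : 1 ≤ u)
    (hD : ∀ s, u < s → |φ u s| ≤ D) : |φ u u| ≤ D := by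
  have hu1 : u < u + 1 := lt_add_one u
  have hcont := (h.phi_ac_v u (u + 1) hu hu1.le).continuousOn
  rw [uIcc_of_le hu1.le] at hcont
  have hlim : Tendsto (fun s => φ u s) (𝓝[>] u) (𝓝 (φ u u)) := by
    rw [← nhdsWithin_Ioc_eq_nhdsGT hu1]
    exact (hcont u ⟨le_rfl, hu1.le⟩).mono Ioc_subset_Icc_self
  refine le_of_tendsto hlim.abs ?_
  filter_upwards [self_mem_nhdsWithin] with s hs using hD s hs

namespace IsLocallyBoundedSolution

theorem abs_dv_rphi_axis_le (h : IsLocallyBoundedSolution φ r m) (hu : 1 ≤ u)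
    (hD : ∀ s, u < s → |φ u s| ≤ D) : |dv (r * φ) u u| ≤ D := by
  by_cases hdiff : DifferentiableWithinAt ℝ (fun v' => (r * φ) u v') (Ioi u) u
  · have hslope := hdiff.hasDerivWithinAt
    rw [hasDerivWithinAt_iff_tendsto_slope' self_notMem_Ioi] at hslope
    refine le_of_tendsto hslope.abs ?_
    filter_upwards [self_mem_nhdsWithin] with s hs
    have hr : r u s ≤ s - u := by linarith [h.r_le hu (mem_Ioi.1 hs).le, sub_pos.2 (mem_Ioi.1 hs)]
    have hr0 := h.r_nonneg hu (mem_Ioi.1 hs).le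
    have hsu : 0 < s - u := sub_pos.2 hs
    have haxis : (r * φ) u u = 0 := by simp [h.r_axis u hu]
    rw [slope_def_field, haxis, sub_zero, abs_div, abs_of_pos hsu, div_le_iff₀' hsu]
    calc |(r * φ) u s| = r u s * |φ u s| := by
          rw [Pi.mul_apply, Pi.mul_apply, abs_mul, abs_of_nonneg hr0]
      _ ≤ (s - u) * D := by gcongr; exact hD s hs
  · -- without a right derivative, `dv` takes the junk value `0`
    rw [dv, derivWithin_zero_of_not_differentiableWithinAt hdiff, abs_zero]
    exact (abs_nonneg _).trans (hD (u + 1) (lt_add_one u))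

theorem abs_du_rphi_sub_le (h : IsLocallyBoundedSolution φ r m) (hu : 1 ≤ u) (h₁ : u < v₁)
    (h₂ : v₁ ≤ v₂) (hD : ∀ s, u < s → |φ u s| ≤ D) :
    |du (r * φ) u v₂ - du (r * φ) u v₁| ≤ D * (du r u v₁ - du r u v₂) := by
  have hle := abs_sub_le_sub_of_ae_hasDerivAt (f := fun s => du (r * φ) u s)
    (g := fun s => -D * du r u s) h₂ (h.du_rphi_ac u v₁ v₂ hu h₁ h₂)
    ((h.nu_ac u v₁ v₂ hu h₁ h₂).const_mul (-D)) <| by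
    filter_upwards [h.ae_hasDerivAt_du_rphi_v hu, h.ae_hasDerivAt_nu_v hu] with s hwave hnu hs
    have hus : u < s := h₁.trans hs.1
    refine ⟨_, _, hwave hus, (hnu hus).const_mul (-D), ?_⟩
    have hp := h.potential_nonpos hu hus
    calc |potential r m u s * φ u s| = -potential r m u s * |φ u s| := by
          rw [abs_mul, abs_of_nonpos hp]
      _ ≤ -potential r m u s * D := mul_le_mul_of_nonneg_left (hD s hus) (neg_nonneg.2 hp)
      _ = -D * potential r m u s := by ring
  linarith

theorem abs_du_rphi_le (h : IsLocallyBoundedSolution φ r m) (hu : 1 ≤ u) (huv : u < v)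
    (hK : -du r u v ≤ K) (hD : ∀ s, u < s → |φ u s| ≤ D)
    (hE : ∀ s, u < s → |dv (r * φ) u s| ≤ X) : |du (r * φ) u v| ≤ X + D * K := by
  have hD0 : 0 ≤ D := (abs_nonneg _).trans (hD v huv)
  have hlim : Tendsto (fun ε => |dv (r * φ) u (u + ε) + du (r * φ) u (u + ε)| + (X + D * K))
      (𝓝[>] 0) (𝓝 (X + D * K)) := by
    simpa using (h.rphi_axis u hu).abs.add_const (X + D * K)
  refine ge_of_tendsto hlim ?_
  filter_upwards [Ioo_mem_nhdsGT (sub_pos.2 huv)] with ε hε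
  have hε₁ : u < u + ε := by linarith [hε.1]
  have hincr := h.abs_du_rphi_sub_le hu hε₁ (v₂ := v) (by linarith [hε.2]) hD
  have hnu : D * (du r u (u + ε) - du r u v) ≤ D * K := by
    gcongr
    linarith [h.nu_neg hu hε₁]
  have hsplit := abs_sub_abs_le_abs_sub (du (r * φ) u (u + ε)) (-dv (r * φ) u (u + ε))
  rw [abs_neg, sub_neg_eq_add, add_comm (du (r * φ) u (u + ε))] at hsplit
  linarith [hE _ hε₁, abs_sub_abs_le_abs_sub (du (r * φ) u v) (du (r * φ) u (u + ε))]

end IsLocallyBoundedSolution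

namespace IsLocallyBoundedSolution

theorem abs_phi_le_mul_min (h : IsLocallyBoundedSolution φ r m) (hu : 1 ≤ u) (huv : u < v)
    (hl : 0 < l) (hX : 0 ≤ X) (hω : 1 < ω) (hlam : ∀ s, u < s → l ≤ dv r u s)
    (hf : ∀ s, u < s → |dv (r * φ) u s| ≤ X * s ^ (-ω)) :
    |φ u v| ≤ (X / l + X / (ω - 1)) * min (u ^ (-ω)) ((r u v)⁻¹ * u ^ (-(ω - 1))) := by
  have hr := h.r_pos u v hu huv
  have hu0 : 0 < u := by linarith
  have hω1 : 0 < ω - 1 := by linarith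
  have hfar := h.abs_rphi_le_of_rpow hu huv hX hω hf
  rw [abs_mul, abs_of_pos hr, ← le_inv_mul_iff₀ hr] at hfar
  rw [mul_min_of_nonneg _ _ (by positivity)]
  refine le_min ((h.abs_phi_le_of_rpow hu huv hl hX (by linarith) hlam hf).trans ?_)
    (hfar.trans ?_)
  · gcongr
    exact le_add_of_nonneg_right (by positivity)
  · rw [mul_left_comm]
    gcongr
    exact le_add_of_nonneg_left (by positivity)

theorem abs_dv_rphi_le_mul_min (h : IsLocallyBoundedSolution φ r m) (hu : 1 ≤ u) (huv : u < v)
    (hX : 0 ≤ X) (hω : 0 ≤ ω) (hf : |dv (r * φ) u v| ≤ X * v ^ (-ω)) :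
    |dv (r * φ) u v| ≤ X * min (u ^ (-ω)) (r u v ^ (-ω)) := by
  have hr := h.r_pos u v hu huv
  have hrv : r u v ≤ v := by linarith [h.r_le hu huv.le]
  refine hf.trans (mul_le_mul_of_nonneg_left (le_min ?_ ?_) hX)
  · exact Real.rpow_le_rpow_of_nonpos (by linarith) huv.le (by linarith)
  · exact Real.rpow_le_rpow_of_nonpos hr hrv (by linarith)

end IsLocallyBoundedSolution

end SSESF

theorem theorem3p1_general {φ r m : ℝ → ℝ → ℝ} {ω I : ℝ} (hω : 1 < ω) (hω3 : ω ≤ 3)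
    (hsol : SSESF.IsLocallyBoundedScattering φ r m)
    (hinit : ∀ v, 1 ≤ v → |SSESF.dv (r * φ) 1 v| ≤ I * v ^ (-ω)) :
    ∃ A₁ : ℝ, 0 < A₁ ∧
      (∀ u v : ℝ, 1 ≤ u → u < v →
        |φ u v| ≤ A₁ * min (u ^ (-ω)) ((r u v)⁻¹ * u ^ (-(ω - 1))) ∧
        |SSESF.dv (r * φ) u v| ≤ A₁ * min (u ^ (-ω)) ((r u v) ^ (-ω)) ∧
        |SSESF.du (r * φ) u v| ≤ A₁ * u ^ (-ω)) ∧
      (∀ u : ℝ, 1 ≤ u →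
        |φ u u| ≤ A₁ * u ^ (-ω) ∧ |SSESF.dv (r * φ) u u| ≤ A₁ * u ^ (-ω)) := by
  have hI : 0 ≤ I := by simpa using (abs_nonneg _).trans (hinit 1 le_rfl)
  obtain ⟨F, hF⟩ := hsol.exists_abs_dv_rphi_le hω hω3 hI hinit
  obtain ⟨K, hK, hnu⟩ := hsol.exists_neg_nu_le hF
  obtain ⟨l, hl, hlam⟩ := hsol.exists_lam_ge
  obtain ⟨B, hB, hdv⟩ := hsol.exists_abs_dv_rphi_le_rpow hω hω3 hI hinit hl hlam hK hnu
  have hω1 : 0 < ω - 1 := by linarith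
  set D := B / l + B / (ω - 1)
  have hD : 0 ≤ D := by positivity
  have hφ : ∀ u v, 1 ≤ u → u < v →
      |φ u v| ≤ D * min (u ^ (-ω)) ((r u v)⁻¹ * u ^ (-(ω - 1))) := fun u v hu huv =>
    hsol.abs_phi_le_mul_min hu huv hl hB hω (fun s => hlam u s hu) fun s => hdv u s hu
  have hdv' : ∀ u v, 1 ≤ u → u < v →
      |SSESF.dv (r * φ) u v| ≤ B * min (u ^ (-ω)) (r u v ^ (-ω)) := fun u v hu huv =>
    hsol.abs_dv_rphi_le_mul_min hu huv hB (by linarith) (hdv u v hu huv)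
  have hφu : ∀ u, 1 ≤ u → ∀ v, u < v → |φ u v| ≤ D * u ^ (-ω) := fun u hu v huv =>
    (hφ u v hu huv).trans (mul_le_mul_of_nonneg_left (min_le_left _ _) hD)
  have hdu : ∀ u v, 1 ≤ u → u < v → |SSESF.du (r * φ) u v| ≤ (B + D * K) * u ^ (-ω) := by
    intro u v hu huv
    refine (hsol.abs_du_rphi_le hu huv (hnu u v hu huv) (hφu u hu) fun s hs =>
      (hdv' u s hu hs).trans (mul_le_mul_of_nonneg_left (min_le_left _ _) hB)).trans_eq ?_
    ring
  have hDK : 0 ≤ D * K := by positivity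
  have enlarge : ∀ {c x : ℝ}, c ≤ B + D + D * K + 1 → 0 ≤ x → c * x ≤ (B + D + D * K + 1) * x :=
    fun hc hx => mul_le_mul_of_nonneg_right hc hx
  refine ⟨B + D + D * K + 1, by positivity, fun u v hu huv => ?_, fun u hu => ?_⟩
  all_goals have hu0 : 0 < u := by linarith
  · have hr := hsol.r_pos u v hu huv
    exact ⟨(hφ u v hu huv).trans (enlarge (by linarith) (by positivity)),
      (hdv' u v hu huv).trans (enlarge (by linarith) (by positivity)),
      (hdu u v hu huv).trans (enlarge (by linarith) (by positivity))⟩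
  · exact ⟨(hsol.abs_phi_axis_le hu (hφu u hu)).trans (enlarge (by linarith) (by positivity)),
      (hsol.abs_dv_rphi_axis_le hu (hφu u hu)).trans (enlarge (by linarith) (by positivity))⟩

theorem theorem3p1 (φ r m : ℝ → ℝ → ℝ) (ω' ω : ℝ) (hω' : 1 < ω') (hω : ω = min ω' 3)
    (hsol : SSESF.IsLocallyBVScattering φ r m)
    (hflat : SSESF.IsAsymptoticallyFlatBV φ r ω') :
    ∃ A₁ : ℝ, 0 < A₁ ∧
      -- off the axis, where `r > 0`
      (∀ u v : ℝ, 1 ≤ u → u < v →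
        |φ u v| ≤ A₁ * min (u ^ (-ω)) ((r u v)⁻¹ * u ^ (-(ω - 1))) ∧
        |SSESF.dv (r * φ) u v| ≤ A₁ * min (u ^ (-ω)) ((r u v) ^ (-ω)) ∧
        |SSESF.du (r * φ) u v| ≤ A₁ * u ^ (-ω)) ∧
      -- on the axis, where `r = 0` and both minima are `u ^ (-ω)`
      (∀ u : ℝ, 1 ≤ u →
        |φ u u| ≤ A₁ * u ^ (-ω) ∧ |SSESF.dv (r * φ) u u| ≤ A₁ * u ^ (-ω)) := by
  have hω1 : 1 < ω := hω ▸ lt_min hω' (by norm_num)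
  obtain ⟨I, hinit⟩ := SSESF.exists_abs_dv_rphi_initial_le hsol.toIsSolution (by linarith)
    (hω ▸ min_le_left _ _) hflat
  exact theorem3p1_general hω1 (hω ▸ min_le_right _ _) hsol.isLocallyBoundedScattering hinit
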